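/- Let $n\ge 4$ and let $C_n$ be the cycle on the vertex set $[n]=\{1,\dots,n\}$. A chord is a pair of distinct vertices that are not adjacent in $C_n$. An instance of cycle vertex-connectivity augmentation (cycle VCA) is a set $S$ of chords (called links) such that the graph $C_n\cup S$ is $3$-vertex-connected. A set $T\subseteq S$ is feasible if $C_n\cup T$ is $3$-vertex-connected, and $\mathrm{OPT}$ denotes a feasible set of minimum size. Chords $ab$ and $cd$ with $a<b$, $c<d$ cross if $a<c<b<d$ or $c<a<d<b$. The circle graph of a set $F\subseteq S$ has vertex set $F$, two links being adjacent iff they cross; $F$ is singleton-free if this graph has no isolated vertex. $V(F)$ denotes the set of endpoints of the links in $F$, and the utility of $F$ is $U(F)=-|F|+\sum_{J}(|V(J)|-3)$, where $J$ runs over the connected components of the circle graph of $F$. For $\alpha\in(1/2,1)$, $N_{\max}\in\mathbb N$ and $F\subseteq S$ call a nonempty set $K\subseteq S\setminus F$ with $|K|\le N_{\max}$ improving for $F$ if $F\cup K$ is singleton-free and $U(F\cup K)-U(F)\ge(1-\alpha)\,|V(F\cup K)\setminus V(F)|$; a singleton-free $F\subseteq S$ is $(\alpha,N_{\max})$-critical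 if no $K$ is improving for $F$. The Local Search algorithm starts with $F=\emptyset$ and, while $F$ is not $(\alpha,N_{\max})$-critical, replaces $F$ by $F\cup K$ for an arbitrary improving $K$; it then picks an arbitrary set $Q\subseteq S$ that is minimal for inclusion among the sets for which $F\cup Q$ is feasible, and returns $(Q,F)$. **Theorem.** Run the Local Search algorithm with $\alpha=8/11$ and any $N_{\max}\ge 9=\lceil\frac{5-2\alpha}{2\alpha-1}\rceil+1$ on an instance $(C_n,S)$. Whatever choices it makes, the algorithm terminates after at most $|S|$ iterations of its loop, every partial run can be continued to an output, and every output $(Q,F)$ satisfies that $Q\cup F$ is feasible and $$|Q\cup F|\le \frac{233}{121}\,|\mathrm{OPT}|,$$ i.e. the approximation ratio of the algorithm is at most $233/121\approx 1.92562$. -/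

import Mathlib

namespace CycleVCA

/-- A graph is `k`-connected if it stays connected after the deletion of any at most `k - 1`
vertices. (Below it is only used for `k = 3` and graphs with at least `4` vertices.) -/
def IsKConnected {V : Type*} (G : SimpleGraph V) (k : ℕ) : Prop :=
  ∀ X : Finset V, X.card < k → (G.induce {v : V | v ∉ X}).Connected

/-- A chord of the cycle `C_n` (on the vertices `0 < 1 < ⋯ < n - 1`): a pair of distinct vertices
that are not adjacent in `C_n`. -/
def IsChord {n : ℕ} (e : Sym2 (Fin n)) : Prop :=
  e ∈ ((SimpleGraph.cycleGraph n)ᶜ).edgeSet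

/-- The set `L` of chords `3`-connects the cycle, i.e. `C_n ∪ L` is `3`-connected. -/
def ThreeConnects {n : ℕ} (L : Finset (Sym2 (Fin n))) : Prop :=
  IsKConnected (SimpleGraph.cycleGraph n ⊔ SimpleGraph.fromEdgeSet (L : Set (Sym2 (Fin n)))) 3

/-- `(C_n, S)` is an instance of the cycle vertex-connectivity augmentation problem. -/
structure IsInstance {n : ℕ} (S : Finset (Sym2 (Fin n))) : Prop where
  isChord : ∀ e ∈ S, IsChord e
  threeConnects : ThreeConnects S

/-- Feasible solutions of the instance `(C_n, S)`. -/
def IsFeasible {n : ℕ} (S T : Finset (Sym2 (Fin n))) : Prop :=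
  T ⊆ S ∧ ThreeConnects T

/-- Optimal solutions of the instance `(C_n, S)`: feasible solutions of minimum size. -/
def IsOptimal {n : ℕ} (S T : Finset (Sym2 (Fin n))) : Prop :=
  IsFeasible S T ∧ ∀ T' : Finset (Sym2 (Fin n)), IsFeasible S T' → T.card ≤ T'.card

/-- Two chords `ab` and `cd`, with `a < b` and `c < d`, cross if `a < c < b < d` or
`c < a < d < b`. -/
def Crosses {n : ℕ} (e f : Sym2 (Fin n)) : Prop :=
  ∃ a b c d : Fin n, e = s(a, b) ∧ f = s(c, d) ∧
    ((a < c ∧ c < b ∧ b < d) ∨ (c < a ∧ a < d ∧ d < b))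

theorem Crosses.symm {n : ℕ} {e f : Sym2 (Fin n)} (h : Crosses e f) : Crosses f e := by
  obtain ⟨a, b, c, d, he, hf, h⟩ := h
  exact ⟨c, d, a, b, hf, he, h.symm⟩

theorem Crosses.irrefl {n : ℕ} (e : Sym2 (Fin n)) : ¬ Crosses e e := by
  rintro ⟨a, b, c, d, he, hf, h⟩
  rw [he] at hf
  rcases Sym2.eq_iff.1 hf with ⟨rfl, rfl⟩ | ⟨rfl, rfl⟩
  · rcases h with h | h
    · exact lt_irrefl _ h.1
    · exact lt_irrefl _ h.1
  · rcases h with ⟨h1, h2, h3⟩ | ⟨h1, h2, h3⟩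
    · exact lt_irrefl _ h2
    · exact lt_irrefl _ h2

/-- The circle graph of a set `L` of chords: its vertices are the chords in `L`, two of them being
adjacent if and only if they cross. -/
def circleGraph {n : ℕ} (L : Finset (Sym2 (Fin n))) : SimpleGraph {e // e ∈ L} where
  Adj e f := Crosses e.1 f.1
  symm := ⟨fun _ _ h => h.symm⟩
  loopless := ⟨fun e => Crosses.irrefl e.1⟩

/-- `V(L)`: the vertices of the cycle that are incident to at least one chord in `L`. -/
def verts {n : ℕ} (L : Finset (Sym2 (Fin n))) : Finset (Fin n) :=
  Finset.univ.filter fun v => ∃ e ∈ L, v ∈ e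

open Classical in
/-- The family of the connected components of the circle graph of `F`, each one given as the set of
the chords in it. -/
noncomputable def circleComponents {n : ℕ} (F : Finset (Sym2 (Fin n))) :
    Finset (Finset (Sym2 (Fin n))) :=
  Finset.univ.image fun c : (circleGraph F).ConnectedComponent =>
    F.filter fun e => ∃ he : e ∈ F, (circleGraph F).connectedComponentMk ⟨e, he⟩ = c

/-- `F` is singleton-free if its circle graph has no isolated vertices. -/
def SingletonFree {n : ℕ} (F : Finset (Sym2 (Fin n))) : Prop :=
  ∀ e : {e // e ∈ F}, ∃ f : {e // e ∈ F}, (circleGraph F).Adj e f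

/-- The utility `U(F) = -|F| + ∑ (|V(J)| - 3)`, where `J` runs over the connected components of
the circle graph of `F`. -/
noncomputable def utility {n : ℕ} (F : Finset (Sym2 (Fin n))) : ℤ :=
  -(F.card : ℤ) + ∑ J ∈ circleComponents F, (((verts J).card : ℤ) - 3)

/-- `K` is a set of links that a step of the first phase may add to `F`. -/
structure IsImprovement {n : ℕ} (α : ℝ) (N : ℕ) (S F K : Finset (Sym2 (Fin n))) : Prop where
  subset : K ⊆ S \ F
  nonempty : K.Nonempty
  card_le : K.card ≤ N
  singletonFree : SingletonFree (F ∪ K)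
  gain : (1 - α) * ((verts (F ∪ K) \ verts F).card : ℝ) ≤ ((utility (F ∪ K) - utility F : ℤ) : ℝ)

/-- `(α, N)`-critical sets of links. -/
structure IsCritical {n : ℕ} (α : ℝ) (N : ℕ) (S F : Finset (Sym2 (Fin n))) : Prop where
  subset : F ⊆ S
  singletonFree : SingletonFree F
  no_improvement : ¬ ∃ K : Finset (Sym2 (Fin n)), IsImprovement α N S F K

/-- `Q` is a completion of `F`: a set of links for which `F ∪ Q` is feasible. -/
def IsCompletion {n : ℕ} (S F Q : Finset (Sym2 (Fin n))) : Prop :=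
  Q ⊆ S ∧ IsFeasible S (F ∪ Q)

/-- One iteration of the while loop of the first phase of the Local Search algorithm leads from
`F` to `F'`. -/
def PhaseOneStep {n : ℕ} (α : ℝ) (N : ℕ) (S F F' : Finset (Sym2 (Fin n))) : Prop :=
  ¬ IsCritical α N S F ∧ ∃ K : Finset (Sym2 (Fin n)), IsImprovement α N S F K ∧ F' = F ∪ K

/-- Finitely many (possibly zero) iterations of the first phase lead from `F` to `F'`. -/
def PhaseOneReaches {n : ℕ} (α : ℝ) (N : ℕ) (S F F' : Finset (Sym2 (Fin n))) : Prop :=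
  Relation.ReflTransGen (PhaseOneStep α N S) F F'

/-- Starting the first phase from `F₀`, the Local Search algorithm (on the instance `(C_n, S)` and
with the parameters `α` and `N`) can return the pair `(Q, F)`: the first phase leads from `F₀` to
the critical set `F`, and `Q` is an inclusion-minimal completion of `F`. The algorithm itself
starts from `F₀ = ∅`. -/
structure ReturnsFrom {n : ℕ} (α : ℝ) (N : ℕ) (S F₀ Q F : Finset (Sym2 (Fin n))) : Prop where
  reaches : PhaseOneReaches α N S F₀ F
  critical : IsCritical α N S F
  minimal : Minimal (IsCompletion S F) Q

end CycleVCA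

/-!
Write `U` for the utility and let `F` be the critical set and `Q` the minimal completion returned by
the algorithm; let `m` be the number of vertices of `F`. The proof combines an upper bound on
`|Q ∪ F|` with a lower bound on the size of an arbitrary feasible solution `O`.

A set of links is feasible if and only if its circle graph is connected and every vertex of the
cycle is covered (`ThreeConnects.linked`, `ThreeConnects.verts_eq_univ`, `Linked.threeConnects`).
The components of the circle graph of `F` span non-overlapping polygons. As these can be
triangulated simultaneously, `∑ (|V(J)| - 2) ≤ |⋃ V(J)| - 2` for any nonempty family of components
(`sum_card_verts_sub_two_le`). Hence adding a connected set `K` of links that touches `r ≥ 1`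
components changes the utility by at least `-|K \ F|`, plus the number of new vertices, plus `r - 1`
(`le_utility_union`).

*Upper bound.* As long as `F ∪ Q'`, with `Q' ⊆ Q`, is not feasible, some link of `Q` merges two
components of `F ∪ Q'` or adds a new vertex to a given component, and can be added without
decreasing `U`. As `Q` is minimal, `F ∪ Q` is reached in this way, and
`U(F ∪ Q) = n - 3 - |F ∪ Q|`, so `|F ∪ Q| ≤ n - 1 - U(F)` (`card_union_completion_le`). Since every
step of the first phase pays `3/11` for each new vertex, `U(F) ≥ 3/11 * m`.

*Lower bound.* It remains to see that `n - 3/11 * m - 1 ≤ 233/121 * |O|`. As `O` covers all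
vertices, `n ≤ 2 * |O|`, and one has to gain `9/121` per link of `O`, either from links with a common
endpoint or from vertices in `V(F)`. A connected set of seven links of `O` with fourteen distinct
endpoints would be an improvement unless it has at least five vertices in common with `F`
(`IsCritical.five_le_card_inter`). Splitting off from `O` again and again a set of six to ten links
that hangs on a single further link (`Linked.exists_hanging`) yields such a gain for each of these
sets (`IsCritical.le_of_linked`). The possible coincidence of endpoints is counted in `n` itself,
and not only in the number of vertices outside of `V(F)`; sets of seven links are then enough.
-/

namespace CycleVCA

/-! ### Connected sets for a relation -/

/-- A finset `A` is linked by a relation `R` if a property that spreads along `R` inside `A` holds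
on all of `A` as soon as it holds somewhere on `A`. For symmetric `R` this says that the graph
induced by `R` on `A` is connected (the empty set being allowed). -/
def Linked {α : Type*} (R : α → α → Prop) (A : Finset α) : Prop :=
  ∀ P : α → Prop, (∀ x ∈ A, ∀ y ∈ A, R x y → P x → P y) → ∀ x ∈ A, P x → ∀ y ∈ A, P y

section Linked

variable {α : Type*} {R : α → α → Prop}

theorem Linked.singleton (a : α) : Linked R {a} := by
  intro P _ x hx hPx y hy
  rw [Finset.mem_singleton] at hx hy
  rwa [hy, ← hx]

variable [DecidableEq α]

/-- A proper nonempty subset of a linked set is left by some related pair. -/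
theorem Linked.exists_boundary {A : Finset α} (hA : Linked R A) {K : Finset α} (hKA : K ⊂ A)
    (hK : K.Nonempty) : ∃ x ∈ K, ∃ y ∈ A \ K, R x y := by
  by_contra! h
  obtain ⟨a, ha⟩ := hK
  refine hKA.2 fun y hy => hA (· ∈ K) (fun x _ y hy hxy hx => ?_) a (hKA.1 ha) ha y hy
  by_contra hyK
  exact h x hx y (Finset.mem_sdiff.2 ⟨hy, hyK⟩) hxy

theorem Linked.union_of_mem {A B : Finset α} (hA : Linked R A) (hB : Linked R B) {c : α}
    (hcA : c ∈ A) (hcB : c ∈ B) : Linked R (A ∪ B) := by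
  intro P hP x hx hPx
  have hA' := hA P fun x hx y hy => hP x (Finset.mem_union_left _ hx) y (Finset.mem_union_left _ hy)
  have hB' := hB P fun x hx y hy =>
    hP x (Finset.mem_union_right _ hx) y (Finset.mem_union_right _ hy)
  have hc : P c := by
    rcases Finset.mem_union.1 hx with h | h
    · exact hA' x h hPx c hcA
    · exact hB' x h hPx c hcB
  intro y hy
  rcases Finset.mem_union.1 hy with h | h
  · exact hA' c hcA hc y h
  · exact hB' c hcB hc y h

theorem Linked.pair (hR : ∀ x y, R x y → R y x) {a b : α} (h : R a b) :
    Linked R ({a, b} : Finset α) := by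
  intro P hP x hx hPx y hy
  have h1 := hP a (by simp) b (by simp) h
  have h2 := hP b (by simp) a (by simp) (hR _ _ h)
  simp only [Finset.mem_insert, Finset.mem_singleton] at hx hy
  rcases hx with rfl | rfl <;> rcases hy with rfl | rfl <;> tauto

theorem Linked.insert_of_rel (hR : ∀ x y, R x y → R y x) {A : Finset α} (hA : Linked R A) {a b : α}
    (ha : a ∈ A) (h : R a b) : Linked R (insert b A) := by
  have := hA.union_of_mem (Linked.pair hR h) ha (by simp)
  convert this using 1
  ext x
  simp only [Finset.mem_insert, Finset.mem_union, Finset.mem_singleton]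
  constructor
  · tauto
  · rintro (h | rfl | h)
    · exact Or.inr h
    · exact Or.inr ha
    · exact Or.inl h

/-- A linked set contains linked sets of all smaller positive sizes around a given element. -/
theorem Linked.exists_subset_card (hR : ∀ x y, R x y → R y x) {A : Finset α} (hA : Linked R A)
    {p : α} (hp : p ∈ A) {k : ℕ} (hk : 1 ≤ k) (hkA : k ≤ A.card) :
    ∃ K ⊆ A, p ∈ K ∧ K.card = k ∧ Linked R K := by
  induction k, hk using Nat.le_induction with
  | base => exact ⟨{p}, by simpa using hp, by simp, by simp, Linked.singleton p⟩
  | succ k _ ih =>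
    obtain ⟨K, hKA, hpK, hcard, hK⟩ := ih (by omega)
    have hss : K ⊂ A := by
      refine Finset.ssubset_iff_subset_ne.2 ⟨hKA, ?_⟩
      rintro rfl
      omega
    obtain ⟨x, hx, y, hy, hxy⟩ := hA.exists_boundary hss ⟨p, hpK⟩
    rw [Finset.mem_sdiff] at hy
    exact ⟨insert y K, Finset.insert_subset hy.1 hKA, Finset.mem_insert_of_mem hpK,
      by rw [Finset.card_insert_of_notMem hy.2, hcard], hK.insert_of_rel hR hx hxy⟩

/-- The connected component of an element of a finset. -/
theorem exists_linked_component (hR : ∀ x y, R x y → R y x) {B : Finset α} {p : α} (hp : p ∈ B) :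
    ∃ C ⊆ B, p ∈ C ∧ Linked R C ∧ ∀ x ∈ C, ∀ y ∈ B \ C, ¬ R x y := by
  classical
  obtain ⟨C, hC, hmax⟩ := (B.powerset.filter fun C => p ∈ C ∧ Linked R C).exists_max_image
    Finset.card ⟨{p}, by simpa using ⟨hp, Linked.singleton p⟩⟩
  rw [Finset.mem_filter, Finset.mem_powerset] at hC
  refine ⟨C, hC.1, hC.2.1, hC.2.2, fun x hx y hy hxy => ?_⟩
  rw [Finset.mem_sdiff] at hy
  have := hmax (insert y C) (by
    rw [Finset.mem_filter, Finset.mem_powerset]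
    exact ⟨Finset.insert_subset hy.1 hC.1, Finset.mem_insert_of_mem hC.2.1,
      hC.2.2.insert_of_rel hR hx hxy⟩)
  rw [Finset.card_insert_of_notMem hy.2] at this
  omega

/-- From a linked set `A` one can split off a set `B` of between `k` and `2k - 2` elements, hanging
on a single further element `p`, without disconnecting the rest. A smallest hanging set with at
least `k` elements will do: if `B` is linked, then hang it on a neighbour of `p` in `B` instead;
otherwise split `B` into two hanging sets. -/
theorem Linked.exists_hanging (hR : ∀ x y, R x y → R y x) {A : Finset α} (hA : Linked R A) {k : ℕ}
    (hk : 2 ≤ k) (hkA : k + 1 ≤ A.card) :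
    ∃ B ⊆ A, ∃ p ∈ A \ B, Linked R (insert p B) ∧ Linked R (A \ B) ∧
      k ≤ B.card ∧ B.card ≤ 2 * k - 2 := by
  classical
  let good : Finset α → Prop := fun B =>
    ∃ p ∈ A \ B, Linked R (insert p B) ∧ Linked R (A \ B) ∧ k ≤ B.card
  have hne : (A.powerset.filter good).Nonempty := by
    obtain ⟨r, hr⟩ : A.Nonempty := Finset.card_pos.1 (by omega)
    refine ⟨A.erase r, ?_⟩
    rw [Finset.mem_filter, Finset.mem_powerset]
    have h1 : A \ A.erase r = {r} := by
      rw [Finset.sdiff_erase_self hr]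
    refine ⟨Finset.erase_subset _ _, r, by simp [h1], ?_, ?_, ?_⟩
    · rwa [Finset.insert_erase hr]
    · rw [h1]
      exact Linked.singleton r
    · rw [Finset.card_erase_of_mem hr]
      omega
  obtain ⟨B, hB, hmin⟩ := (A.powerset.filter good).exists_min_image Finset.card hne
  rw [Finset.mem_filter, Finset.mem_powerset] at hB
  obtain ⟨hBA, p, hp, hpB, hAB, hkB⟩ := hB
  refine ⟨B, hBA, p, hp, hpB, hAB, hkB, ?_⟩
  rw [Finset.mem_sdiff] at hp
  have hmin' : ∀ B' ⊆ A, good B' → B.card ≤ B'.card := fun B' h1 h2 =>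
    hmin B' (by rw [Finset.mem_filter, Finset.mem_powerset]; exact ⟨h1, h2⟩)
  obtain ⟨x, hx, q, hq, hpq⟩ := hpB.exists_boundary (K := {p})
    (by
      refine Finset.ssubset_iff_subset_ne.2 ⟨by simp, fun h => ?_⟩
      have := congrArg Finset.card h
      rw [Finset.card_insert_of_notMem hp.2, Finset.card_singleton] at this
      omega) (by simp)
  rw [Finset.mem_singleton] at hx
  subst hx
  have hqB : q ∈ B := by
    simp only [Finset.mem_sdiff, Finset.mem_insert, Finset.mem_singleton] at hq
    tauto
  obtain ⟨C, hCB, hqC, hC, hCiso⟩ := exists_linked_component hR hqB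
  by_cases hCeq : C = B
  · subst hCeq
    have := hmin' (C.erase q) ((Finset.erase_subset _ _).trans hBA)
    by_contra hcon
    have h2 := Finset.card_erase_of_mem hqC
    have h3 := this ⟨q, by simp [hBA hqC], by rwa [Finset.insert_erase hqC], by
      have : A \ C.erase q = insert q (A \ C) := by
        ext z
        simp only [Finset.mem_sdiff, Finset.mem_erase, Finset.mem_insert]
        have : z = q → z ∈ A := fun h => h ▸ hBA hqC
        tauto
      rw [this]
      exact hAB.insert_of_rel hR (Finset.mem_sdiff.2 hp) hpq, by omega⟩
    omega
  · -- The component `C` and its complement `B \ C` in `B` both hang on `x`.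
    have hDB : B \ C ⊆ B := Finset.sdiff_subset
    have hDlink : Linked R (insert x (B \ C)) := by
      intro P hP a ha hPa
      -- Every element of `B \ C` reaches `x` without entering `C`.
      have key : ∀ Q : α → Prop,
          (∀ u ∈ insert x (B \ C), ∀ v ∈ insert x (B \ C), R u v → Q u → Q v) →
          ∀ u ∈ insert x (B \ C), Q u → Q x := by
        intro Q hQ u hu hQu
        by_contra hQx
        have := hpB (fun z => z ∈ insert x (B \ C) ∧ Q z) ?_ u
          (Finset.insert_subset_insert _ hDB hu) ⟨hu, hQu⟩ x (by simp)
        · exact hQx this.2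
        rintro y hy z hz hyz ⟨hy', hQy⟩
        have hyx : y ≠ x := fun h => hQx (h ▸ hQy)
        have hyD : y ∈ B \ C := Finset.mem_of_mem_insert_of_ne hy' hyx
        have hz' : z ∈ insert x (B \ C) := by
          rcases Finset.mem_insert.1 hz with rfl | hzB
          · simp
          · refine Finset.mem_insert_of_mem (Finset.mem_sdiff.2 ⟨hzB, fun hzC => ?_⟩)
            exact hCiso z hzC y hyD (hR _ _ hyz)
        exact ⟨hz', hQ y hy' z hz' hyz hQy⟩
      have hPx := key P hP a ha hPa
      intro b hb
      by_contra hPb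
      refine key (fun z => ¬ P z) (fun u hu v hv huv hPu hPv => hPu ?_) b hb hPb hPx
      exact hP v hv u hu (hR _ _ huv) hPv
    have hClink : Linked R (insert x C) := hC.insert_of_rel hR hqC (hR _ _ hpq)
    have h1 : ¬ k ≤ C.card := fun h => by
      have := hmin' C (hCB.trans hBA) ⟨x, Finset.mem_sdiff.2 ⟨hp.1, fun h => hp.2 (hCB h)⟩,
        hClink, ?_, h⟩
      · exact hCeq (Finset.eq_of_subset_of_card_le hCB this)
      · convert hAB.union_of_mem hDlink (Finset.mem_sdiff.2 hp) (Finset.mem_insert_self _ _) using 1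
        ext z
        simp only [Finset.mem_sdiff, Finset.mem_union, Finset.mem_insert]
        have := @hBA z
        have := @hCB z
        have : z = x → z ∈ A ∧ z ∉ B := fun h => h ▸ hp
        tauto
    have hcard := Finset.card_sdiff_add_card_eq_card hCB
    have hCpos : 0 < C.card := Finset.card_pos.2 ⟨q, hqC⟩
    have h2 : ¬ k ≤ (B \ C).card := fun h => by
      have := hmin' (B \ C) (hDB.trans hBA) ⟨x, Finset.mem_sdiff.2 ⟨hp.1, fun h => hp.2 (hDB h)⟩,
        hDlink, ?_, h⟩
      · omega
      · convert hAB.union_of_mem hClink (Finset.mem_sdiff.2 hp) (Finset.mem_insert_self _ _) using 1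
        ext z
        simp only [Finset.mem_sdiff, Finset.mem_union, Finset.mem_insert]
        have := @hBA z
        have := @hCB z
        have : z = x → z ∈ A ∧ z ∉ B := fun h => h ▸ hp
        tauto
    omega

end Linked

/-! ### Geometry of crossing chords -/

variable {n : ℕ}

theorem mem_verts {L : Finset (Sym2 (Fin n))} {v : Fin n} : v ∈ verts L ↔ ∃ e ∈ L, v ∈ e := by
  simp [verts]

theorem verts_mono {A B : Finset (Sym2 (Fin n))} (h : A ⊆ B) : verts A ⊆ verts B := by
  intro v hv
  obtain ⟨e, he, hve⟩ := mem_verts.1 hv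
  exact mem_verts.2 ⟨e, h he, hve⟩

theorem verts_union (A B : Finset (Sym2 (Fin n))) : verts (A ∪ B) = verts A ∪ verts B := by
  ext v
  simp only [mem_verts, Finset.mem_union]
  grind

theorem verts_singleton_mk (a b : Fin n) : verts {s(a, b)} = {a, b} := by
  ext v
  simp [mem_verts]

theorem card_verts_singleton_le (e : Sym2 (Fin n)) : (verts {e}).card ≤ 2 := by
  induction e using Sym2.ind with
  | _ a b =>
    rw [verts_singleton_mk]
    exact Finset.card_le_two

theorem card_verts_singleton {e : Sym2 (Fin n)} (he : ¬ e.IsDiag) : (verts {e}).card = 2 := by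
  induction e using Sym2.ind with
  | _ a b =>
    rw [verts_singleton_mk]
    exact Finset.card_pair (by simpa using he)

theorem card_verts_le (L : Finset (Sym2 (Fin n))) : (verts L).card ≤ 2 * L.card := by
  induction L using Finset.induction_on with
  | empty => simp [verts]
  | insert e L he ih =>
    rw [Finset.insert_eq, verts_union, ← Finset.insert_eq, Finset.card_insert_of_notMem he]
    have := Finset.card_union_le (verts {e}) (verts L)
    have := card_verts_singleton_le e
    omega

theorem exists_eq_mk_le (e : Sym2 (Fin n)) : ∃ a b : Fin n, a ≤ b ∧ e = s(a, b) := by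
  induction e using Sym2.ind with
  | _ a b =>
    rcases le_total a b with h | h
    · exact ⟨a, b, h, rfl⟩
    · exact ⟨b, a, h, Sym2.eq_swap⟩

theorem crosses_mk_iff {a b c d : Fin n} (hab : a ≤ b) (hcd : c ≤ d) :
    Crosses s(a, b) s(c, d) ↔ (a < c ∧ c < b ∧ b < d) ∨ (c < a ∧ a < d ∧ d < b) := by
  constructor
  · rintro ⟨a', b', c', d', h1, h2, h⟩
    rcases Sym2.eq_iff.1 h1 with ⟨rfl, rfl⟩ | ⟨rfl, rfl⟩ <;>
    rcases Sym2.eq_iff.1 h2 with ⟨rfl, rfl⟩ | ⟨rfl, rfl⟩ <;> omega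
  · exact fun h => ⟨a, b, c, d, rfl, rfl, h⟩

theorem crosses_symm : ∀ e f : Sym2 (Fin n), Crosses e f → Crosses f e := fun _ _ h => h.symm

/-- A connected set of chords none of which crosses `cd` lies on one side of `cd`. -/
theorem Linked.verts_between {J : Finset (Sym2 (Fin n))} (hJ : Linked Crosses J) {c d v : Fin n}
    (h : ∀ g ∈ J, ¬ Crosses g s(c, d)) (hv : v ∈ verts J) (hcv : c < v) (hvd : v < d) :
    ∀ w ∈ verts J, c ≤ w ∧ w ≤ d := by
  obtain ⟨e, he, hve⟩ := mem_verts.1 hv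
  have hcd : c ≤ d := by omega
  have key := hJ (fun g => ∀ w ∈ g, c ≤ w ∧ w ≤ d) ?_ e he ?_
  · intro w hw
    obtain ⟨g, hg, hwg⟩ := mem_verts.1 hw
    exact key g hg w hwg
  · intro x hx y hy hxy hPx
    have h1 := h x hx
    have h2 := h y hy
    obtain ⟨x1, x2, hx12, rfl⟩ := exists_eq_mk_le x
    obtain ⟨y1, y2, hy12, rfl⟩ := exists_eq_mk_le y
    rw [crosses_mk_iff hx12 hcd] at h1
    rw [crosses_mk_iff hy12 hcd] at h2
    rw [crosses_mk_iff hx12 hy12] at hxy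
    simp only [Sym2.mem_iff, forall_eq_or_imp, forall_eq] at hPx ⊢
    omega
  · have h1 := h e he
    obtain ⟨x1, x2, hx12, rfl⟩ := exists_eq_mk_le e
    rw [crosses_mk_iff hx12 hcd] at h1
    simp only [Sym2.mem_iff, forall_eq_or_imp, forall_eq] at hve ⊢
    omega

/-- A chord that separates two vertices of a connected set of chords crosses one of these chords. -/
theorem Linked.exists_crosses {J : Finset (Sym2 (Fin n))} (hJ : Linked Crosses J) {u v : Fin n}
    (hu : u ∈ verts J) (hv : v ∈ verts J) {e : Sym2 (Fin n)} (he : Crosses s(u, v) e) :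
    ∃ g ∈ J, Crosses g e := by
  by_contra! h
  wlog huv : u ≤ v generalizing u v
  · exact this hv hu (by rwa [Sym2.eq_swap]) (by omega)
  obtain ⟨x, y, hxy, rfl⟩ := exists_eq_mk_le e
  rw [crosses_mk_iff huv hxy] at he
  rcases he with he | he
  · have := hJ.verts_between h hv (by omega) (by omega) u hu
    omega
  · have := hJ.verts_between h hu (by omega) (by omega) v hv
    omega

/-- A connected set of chords has a chord jumping over each of its vertices, except for the
smallest and the largest. -/
theorem Linked.exists_jump {J : Finset (Sym2 (Fin n))} (hJ : Linked Crosses J) {x y z : Fin n}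
    (hy : y ∈ verts J) (hz : z ∈ verts J) (hyx : y < x) (hxz : x < z) :
    ∃ a b : Fin n, s(a, b) ∈ J ∧ a < x ∧ x < b := by
  by_contra! h
  obtain ⟨e, he, hye⟩ := mem_verts.1 hy
  obtain ⟨f, hf, hzf⟩ := mem_verts.1 hz
  have key := hJ (fun g => ∀ w ∈ g, w ≤ x) ?_ e he ?_ f hf z hzf
  · omega
  · intro p hp q hq hpq hP
    obtain ⟨p1, p2, hp12, rfl⟩ := exists_eq_mk_le p
    obtain ⟨q1, q2, hq12, rfl⟩ := exists_eq_mk_le q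
    have := h q1 q2 hq
    rw [crosses_mk_iff hp12 hq12] at hpq
    simp only [Sym2.mem_iff, forall_eq_or_imp, forall_eq] at hP ⊢
    omega
  · obtain ⟨p1, p2, hp12, rfl⟩ := exists_eq_mk_le e
    have := h p1 p2 he
    simp only [Sym2.mem_iff, forall_eq_or_imp, forall_eq] at hye ⊢
    omega

/-- Two disjoint connected sets of chords that do not cross each other have no common vertex that
lies strictly between the smallest and the largest vertex of both. -/
theorem Linked.eq_of_common_inner {J J' : Finset (Sym2 (Fin n))} (hJ : Linked Crosses J)
    (hJ' : Linked Crosses J') (hcross : ∀ e ∈ J, ∀ f ∈ J', ¬ Crosses e f) {x y z y' z' : Fin n}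
    (hx : x ∈ verts J) (hy : y ∈ verts J) (hz : z ∈ verts J) (hyx : y < x) (hxz : x < z)
    (hx' : x ∈ verts J') (hy' : y' ∈ verts J') (hz' : z' ∈ verts J') (hyx' : y' < x)
    (hxz' : x < z') : ∃ e ∈ J, e ∈ J' := by
  obtain ⟨a, b, hab, hax, hxb⟩ := hJ.exists_jump hy hz hyx hxz
  obtain ⟨c, d, hcd, hcx, hxd⟩ := hJ'.exists_jump hy' hz' hyx' hxz'
  have h1 := hJ.verts_between (c := c) (d := d) (fun g hg => hcross g hg _ hcd) hx hcx hxd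
  have h2 := hJ'.verts_between (c := a) (d := b)
    (fun g hg h => hcross _ hab g hg h.symm) hx' hax hxb
  have ha := h1 a (mem_verts.2 ⟨_, hab, by simp⟩)
  have hb := h1 b (mem_verts.2 ⟨_, hab, by simp⟩)
  have hc := h2 c (mem_verts.2 ⟨_, hcd, by simp⟩)
  have hd := h2 d (mem_verts.2 ⟨_, hcd, by simp⟩)
  have e1 : a = c := by omega
  have e2 : b = d := by omega
  subst e1 e2
  exact ⟨_, hab, hcd⟩

/-- The vertices of `L` other than the smallest and the largest one. -/
def innerVerts (L : Finset (Sym2 (Fin n))) : Finset (Fin n) :=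
  (verts L).filter fun x => (∃ y ∈ verts L, y < x) ∧ ∃ z ∈ verts L, x < z

theorem card_verts_le_card_innerVerts (L : Finset (Sym2 (Fin n))) :
    (verts L).card ≤ (innerVerts L).card + 2 := by
  rcases (verts L).eq_empty_or_nonempty with h | h
  · simp [h]
  · have : verts L ⊆ innerVerts L ∪ {(verts L).min' h, (verts L).max' h} := by
      intro x hx
      have h1 := Finset.min'_le _ x hx
      have h2 := Finset.le_max' _ x hx
      have h3 := Finset.min'_mem _ h
      have h4 := Finset.max'_mem _ h
      simp only [innerVerts, Finset.mem_union, Finset.mem_filter, Finset.mem_insert,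
        Finset.mem_singleton]
      rcases h1.lt_or_eq with h1 | h1
      · rcases h2.lt_or_eq with h2 | h2
        · exact Or.inl ⟨hx, ⟨_, h3, h1⟩, _, h4, h2⟩
        · exact Or.inr (Or.inr h2)
      · exact Or.inr (Or.inl h1.symm)
    have h1 := Finset.card_le_card this
    have h2 := Finset.card_union_le (innerVerts L) {(verts L).min' h, (verts L).max' h}
    have h3 : ({(verts L).min' h, (verts L).max' h} : Finset (Fin n)).card ≤ 2 :=
      Finset.card_le_two
    omega

theorem card_innerVerts_add_two_le {L : Finset (Sym2 (Fin n))} (h : 2 ≤ (verts L).card) :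
    (innerVerts L).card + 2 ≤ (verts L).card := by
  have hne : (verts L).Nonempty := Finset.card_pos.1 (by omega)
  have hlt := Finset.min'_lt_max'_of_card _ (show 1 < (verts L).card by omega)
  have h3 := Finset.min'_mem _ hne
  have h4 := Finset.max'_mem _ hne
  have hsub : innerVerts L ⊆ verts L \ {(verts L).min' hne, (verts L).max' hne} := by
    intro x hx
    simp only [innerVerts, Finset.mem_filter] at hx
    obtain ⟨hx, ⟨y, hy, hyx⟩, z, hz, hxz⟩ := hx
    simp only [Finset.mem_sdiff, Finset.mem_insert, Finset.mem_singleton, not_or]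
    have h1 := Finset.min'_le _ y hy
    have h2 := Finset.le_max' _ z hz
    exact ⟨hx, (h1.trans_lt hyx).ne', (hxz.trans_le h2).ne⟩
  have := Finset.card_le_card hsub
  have h5 : ({(verts L).min' hne, (verts L).max' hne} : Finset (Fin n)) ⊆ verts L := by
    intro x hx
    simp only [Finset.mem_insert, Finset.mem_singleton] at hx
    rcases hx with rfl | rfl <;> assumption
  have h6 := Finset.card_sdiff_add_card_eq_card h5
  have h7 : ({(verts L).min' hne, (verts L).max' hne} : Finset (Fin n)).card = 2 :=
    Finset.card_pair (ne_of_lt hlt)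
  omega

/-- Non-crossing connected sets of chords span non-overlapping polygons, and a polygon with `m`
vertices is cut into `m - 2` triangles. The count is done with the inner vertices: no vertex is an
inner vertex of two of the polygons. -/
theorem sum_card_verts_sub_two_le {I : Finset (Finset (Sym2 (Fin n)))} (hI : I.Nonempty)
    (hlink : ∀ J ∈ I, Linked Crosses J)
    (hdisj : ∀ J ∈ I, ∀ J' ∈ I, ∀ e ∈ J, e ∈ J' → J = J')
    (hcross : ∀ J ∈ I, ∀ J' ∈ I, J ≠ J' → ∀ e ∈ J, ∀ f ∈ J', ¬ Crosses e f)
    (hne : ∀ J ∈ I, 2 ≤ (verts J).card) :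
    ∑ J ∈ I, (((verts J).card : ℤ) - 2) ≤ ((verts (I.biUnion id)).card : ℤ) - 2 := by
  have hsub : ∀ J ∈ I, verts J ⊆ verts (I.biUnion id) := fun J hJ =>
    verts_mono (Finset.subset_biUnion_of_mem id hJ)
  have h1 : ∑ J ∈ I, (((verts J).card : ℤ) - 2) ≤ ∑ J ∈ I, ((innerVerts J).card : ℤ) := by
    refine Finset.sum_le_sum fun J _ => ?_
    have := card_verts_le_card_innerVerts J
    omega
  have h2 : (I.biUnion innerVerts).card = ∑ J ∈ I, (innerVerts J).card := by
    refine Finset.card_biUnion fun J hJ J' hJ' hJJ' => ?_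
    rw [Function.onFun, Finset.disjoint_left]
    intro x hx hx'
    simp only [innerVerts, Finset.mem_filter] at hx hx'
    obtain ⟨hx, ⟨y, hy, hyx⟩, z, hz, hxz⟩ := hx
    obtain ⟨hx', ⟨y', hy', hyx'⟩, z', hz', hxz'⟩ := hx'
    obtain ⟨e, he, he'⟩ := (hlink J hJ).eq_of_common_inner (hlink J' hJ') (hcross J hJ J' hJ' hJJ')
      hx hy hz hyx hxz hx' hy' hz' hyx' hxz'
    exact hJJ' (hdisj J hJ J' hJ' e he he')
  have h3 : I.biUnion innerVerts ⊆ innerVerts (I.biUnion id) := by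
    intro x hx
    obtain ⟨J, hJ, hx⟩ := Finset.mem_biUnion.1 hx
    simp only [innerVerts, Finset.mem_filter] at hx ⊢
    obtain ⟨hx, ⟨y, hy, hyx⟩, z, hz, hxz⟩ := hx
    exact ⟨hsub J hJ hx, ⟨y, hsub J hJ hy, hyx⟩, z, hsub J hJ hz, hxz⟩
  obtain ⟨J, hJ⟩ := hI
  have h4 : 2 ≤ (verts (I.biUnion id)).card := (hne J hJ).trans (Finset.card_le_card (hsub J hJ))
  have h5 := card_innerVerts_add_two_le h4
  have h6 := Finset.card_le_card h3
  have h7 : ∑ J ∈ I, ((innerVerts J).card : ℤ) = ((I.biUnion innerVerts).card : ℤ) := by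
    rw [h2]
    push_cast
    rfl
  omega

/-! ### Components of the circle graph and the utility -/

/-- The components of the circle graph are the nonempty connected sets of chords which cross no
other chord. -/
theorem mem_circleComponents {F J : Finset (Sym2 (Fin n))} :
    J ∈ circleComponents F ↔ J ⊆ F ∧ J.Nonempty ∧ Linked Crosses J ∧
      ∀ e ∈ J, ∀ f ∈ F, f ∉ J → ¬ Crosses e f := by
  classical
  simp only [circleComponents, Finset.mem_image, Finset.mem_univ, true_and]
  constructor
  · rintro ⟨c, rfl⟩
    refine ⟨Finset.filter_subset _ _, ?_, ?_, ?_⟩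
    · induction c using SimpleGraph.ConnectedComponent.ind with
      | _ e => exact ⟨e.1, Finset.mem_filter.2 ⟨e.2, e.2, rfl⟩⟩
    · intro P hP x hx hPx y hy
      obtain ⟨hx, hx', hxc⟩ := Finset.mem_filter.1 hx
      obtain ⟨hy, hy', hyc⟩ := Finset.mem_filter.1 hy
      by_contra hPy
      obtain ⟨p⟩ := SimpleGraph.ConnectedComponent.exact (hxc.trans hyc.symm)
      obtain ⟨d, -, hd1, hd2⟩ := p.exists_boundary_dart
        {e | (circleGraph F).connectedComponentMk e = c ∧ P e.1} ⟨hxc, hPx⟩ fun h => hPy h.2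
      have hd3 : (circleGraph F).connectedComponentMk d.snd = c := by
        rw [← hd1.1]
        exact (SimpleGraph.ConnectedComponent.sound d.adj.reachable).symm
      refine hd2 ⟨hd3, hP d.fst.1 ?_ d.snd.1 ?_ d.adj hd1.2⟩
      · exact Finset.mem_filter.2 ⟨d.fst.2, d.fst.2, hd1.1⟩
      · exact Finset.mem_filter.2 ⟨d.snd.2, d.snd.2, hd3⟩
    · intro e he f hf hfJ hef
      obtain ⟨he, he', hec⟩ := Finset.mem_filter.1 he
      refine hfJ (Finset.mem_filter.2 ⟨hf, hf, ?_⟩)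
      rw [← hec]
      have : (circleGraph F).Adj ⟨e, he'⟩ ⟨f, hf⟩ := hef
      exact (SimpleGraph.ConnectedComponent.sound this.reachable).symm
  · rintro ⟨hJF, ⟨e, he⟩, hJ, hiso⟩
    refine ⟨(circleGraph F).connectedComponentMk ⟨e, hJF he⟩, ?_⟩
    ext f
    rw [Finset.mem_filter]
    constructor
    · rintro ⟨hf, hf', hfc⟩
      obtain ⟨p⟩ := SimpleGraph.ConnectedComponent.exact hfc.symm
      by_contra hfJ
      obtain ⟨d, -, hd1, hd2⟩ := p.exists_boundary_dart {e | e.1 ∈ J} he hfJ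
      exact hiso _ hd1 _ d.snd.2 hd2 d.adj
    · intro hf
      refine ⟨hJF hf, hJ (fun g => ∃ hg : g ∈ F, (circleGraph F).connectedComponentMk ⟨g, hg⟩ =
        (circleGraph F).connectedComponentMk ⟨e, hJF he⟩) ?_ e he ⟨hJF he, rfl⟩ f hf⟩
      rintro x hx y hy hxy ⟨hxF, hxe⟩
      refine ⟨hJF hy, ?_⟩
      rw [← hxe]
      have : (circleGraph F).Adj ⟨x, hxF⟩ ⟨y, hJF hy⟩ := hxy
      exact (SimpleGraph.ConnectedComponent.sound this.reachable).symm

theorem exists_mem_circleComponents {F : Finset (Sym2 (Fin n))} {e : Sym2 (Fin n)} (he : e ∈ F) :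
    ∃ J ∈ circleComponents F, e ∈ J := by
  obtain ⟨C, hCF, heC, hC, hiso⟩ := exists_linked_component crosses_symm he
  exact ⟨C, mem_circleComponents.2 ⟨hCF, ⟨e, heC⟩, hC, fun x hx f hf hfC =>
    hiso x hx f (Finset.mem_sdiff.2 ⟨hf, hfC⟩)⟩, heC⟩

/-- A connected subset of `F` which meets a component of `F` is contained in it. -/
theorem Linked.subset_component {F J K : Finset (Sym2 (Fin n))} (hK : Linked Crosses K)
    (hKF : K ⊆ F) (hJ : J ∈ circleComponents F) {e : Sym2 (Fin n)} (heK : e ∈ K) (heJ : e ∈ J) :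
    K ⊆ J := by
  obtain ⟨-, -, -, hiso⟩ := mem_circleComponents.1 hJ
  refine fun f hf => hK (· ∈ J) (fun x hx y hy hxy hxJ => ?_) e heK heJ f hf
  by_contra hyJ
  exact hiso x hxJ y (hKF hy) hyJ hxy

theorem eq_of_mem_circleComponents {F J J' : Finset (Sym2 (Fin n))} (hJ : J ∈ circleComponents F)
    (hJ' : J' ∈ circleComponents F) {e : Sym2 (Fin n)} (heJ : e ∈ J) (heJ' : e ∈ J') : J = J' := by
  obtain ⟨h1, -, h2, -⟩ := mem_circleComponents.1 hJ
  obtain ⟨h1', -, h2', -⟩ := mem_circleComponents.1 hJ'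
  exact (h2.subset_component h1 hJ' heJ heJ').antisymm (h2'.subset_component h1' hJ heJ' heJ)

theorem circleComponents_of_linked {F : Finset (Sym2 (Fin n))} (hF : Linked Crosses F)
    (hne : F.Nonempty) : circleComponents F = {F} := by
  have hFF : F ∈ circleComponents F :=
    mem_circleComponents.2 ⟨subset_rfl, hne, hF, fun _ _ f hf hf' => absurd hf hf'⟩
  ext J
  rw [Finset.mem_singleton]
  constructor
  · intro hJ
    obtain ⟨h1, ⟨e, he⟩, -⟩ := mem_circleComponents.1 hJ
    exact eq_of_mem_circleComponents hJ hFF he (h1 he)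
  · rintro rfl
    exact hFF

theorem utility_empty : utility (∅ : Finset (Sym2 (Fin n))) = 0 := by
  have : circleComponents (∅ : Finset (Sym2 (Fin n))) = ∅ := by
    rw [Finset.eq_empty_iff_forall_notMem]
    intro J hJ
    obtain ⟨h1, ⟨e, he⟩, -⟩ := mem_circleComponents.1 hJ
    simpa using h1 he
  simp [utility, this]

open Classical in
/-- The components of `F` that share a chord with `K` or are crossed by a chord of `K`. -/
noncomputable def touchedComponents (F K : Finset (Sym2 (Fin n))) :
    Finset (Finset (Sym2 (Fin n))) :=
  (circleComponents F).filter fun J => ∃ e ∈ J, ∃ f ∈ K, e = f ∨ Crosses e f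

theorem mem_touchedComponents {F K J : Finset (Sym2 (Fin n))} :
    J ∈ touchedComponents F K ↔
      J ∈ circleComponents F ∧ ∃ e ∈ J, ∃ f ∈ K, e = f ∨ Crosses e f := by
  classical
  simp [touchedComponents]

/-- Adding a connected set `K` to `F` merges the components touched by `K` into one component and
leaves the other components unchanged. -/
theorem circleComponents_union {F K : Finset (Sym2 (Fin n))} (hK : Linked Crosses K)
    (hne : K.Nonempty) :
    circleComponents (F ∪ K) =
        insert (K ∪ (touchedComponents F K).biUnion id)
          (circleComponents F \ touchedComponents F K) ∧
      K ∪ (touchedComponents F K).biUnion id ∉ circleComponents F \ touchedComponents F K := by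
  set T := K ∪ (touchedComponents F K).biUnion id with hT
  have hmemT : ∀ e, e ∈ T ↔ e ∈ K ∨ ∃ J ∈ touchedComponents F K, e ∈ J := by
    intro e
    simp [hT]
  have hTF : T ⊆ F ∪ K := by
    intro e he
    rcases (hmemT e).1 he with h | ⟨J, hJ, heJ⟩
    · exact Finset.mem_union_right _ h
    · exact Finset.mem_union_left _
        ((mem_circleComponents.1 (mem_touchedComponents.1 hJ).1).1 heJ)
  obtain ⟨k, hk⟩ := hne
  have hTlink : Linked Crosses T := by
    intro P hP
    have hKP : ∀ Q : Sym2 (Fin n) → Prop, (∀ x ∈ T, ∀ y ∈ T, Crosses x y → Q x → Q y) →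
        ∀ x ∈ K, Q x → ∀ y ∈ K, Q y := fun Q hQ =>
      hK Q fun x hx y hy => hQ x ((hmemT x).2 (Or.inl hx)) y ((hmemT y).2 (Or.inl hy))
    have hJP : ∀ J ∈ touchedComponents F K, ∀ Q : Sym2 (Fin n) → Prop,
        (∀ x ∈ T, ∀ y ∈ T, Crosses x y → Q x → Q y) → ∀ x ∈ J, Q x → ∀ y ∈ J, Q y :=
      fun J hJ Q hQ => (mem_circleComponents.1 (mem_touchedComponents.1 hJ).1).2.2.1 Q
        fun x hx y hy => hQ x ((hmemT x).2 (Or.inr ⟨J, hJ, hx⟩)) y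
          ((hmemT y).2 (Or.inr ⟨J, hJ, hy⟩))
    have key : ∀ Q : Sym2 (Fin n) → Prop, (∀ x ∈ T, ∀ y ∈ T, Crosses x y → Q x → Q y) →
        ∀ x ∈ T, Q x → Q k := by
      intro Q hQ x hx hQx
      rcases (hmemT x).1 hx with h | ⟨J, hJ, hxJ⟩
      · exact hKP Q hQ x h hQx k hk
      · obtain ⟨e, he, f, hf, hef⟩ := (mem_touchedComponents.1 hJ).2
        have hQe := hJP J hJ Q hQ x hxJ hQx e he
        refine hKP Q hQ f hf ?_ k hk
        rcases hef with rfl | hef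
        · exact hQe
        · exact hQ e ((hmemT e).2 (Or.inr ⟨J, hJ, he⟩)) f ((hmemT f).2 (Or.inl hf)) hef hQe
    intro x hx hPx y hy
    have hPk := key P hP x hx hPx
    by_contra hPy
    exact key (fun z => ¬ P z) (fun u hu v hv huv hPu hPv => hPu (hP v hv u hu huv.symm hPv))
      y hy hPy hPk
  have hTmem : T ∈ circleComponents (F ∪ K) := by
    refine mem_circleComponents.2 ⟨hTF, ⟨k, (hmemT k).2 (Or.inl hk)⟩, hTlink, ?_⟩
    intro e he f hf hfT hef
    have hfF : f ∈ F := by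
      rcases Finset.mem_union.1 hf with h | h
      · exact h
      · exact absurd ((hmemT f).2 (Or.inl h)) hfT
    rcases (hmemT e).1 he with h | ⟨J, hJ, heJ⟩
    · obtain ⟨J', hJ', hfJ'⟩ := exists_mem_circleComponents hfF
      exact hfT ((hmemT f).2 (Or.inr ⟨J', mem_touchedComponents.2
        ⟨hJ', f, hfJ', e, h, Or.inr hef.symm⟩, hfJ'⟩))
    · refine (mem_circleComponents.1 (mem_touchedComponents.1 hJ).1).2.2.2 e heJ f hfF ?_ hef
      exact fun hfJ => hfT ((hmemT f).2 (Or.inr ⟨J, hJ, hfJ⟩))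
  have hold : ∀ J ∈ circleComponents F \ touchedComponents F K, J ∈ circleComponents (F ∪ K) := by
    intro J hJ
    obtain ⟨hJF, hJt⟩ := Finset.mem_sdiff.1 hJ
    obtain ⟨h1, h2, h3, h4⟩ := mem_circleComponents.1 hJF
    refine mem_circleComponents.2 ⟨h1.trans Finset.subset_union_left, h2, h3, ?_⟩
    intro e he f hf hfJ hef
    rcases Finset.mem_union.1 hf with h | h
    · exact h4 e he f h hfJ hef
    · exact hJt (mem_touchedComponents.2 ⟨hJF, e, he, f, h, Or.inr hef⟩)
  constructor
  · ext J
    rw [Finset.mem_insert]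
    constructor
    · intro hJ
      obtain ⟨h1, ⟨e, he⟩, -⟩ := mem_circleComponents.1 hJ
      by_cases heT : e ∈ T
      · exact Or.inl (eq_of_mem_circleComponents hJ hTmem he heT)
      · have heF : e ∈ F := by
          rcases Finset.mem_union.1 (h1 he) with h | h
          · exact h
          · exact absurd ((hmemT e).2 (Or.inl h)) heT
        obtain ⟨J', hJ', heJ'⟩ := exists_mem_circleComponents heF
        have hJ'' : J' ∈ circleComponents F \ touchedComponents F K :=
          Finset.mem_sdiff.2 ⟨hJ', fun h => heT ((hmemT e).2 (Or.inr ⟨J', h, heJ'⟩))⟩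
        rw [eq_of_mem_circleComponents hJ (hold J' hJ'') he heJ']
        exact Or.inr hJ''
    · rintro (rfl | h)
      · exact hTmem
      · exact hold J h
  · intro h
    obtain ⟨h1, h2⟩ := Finset.mem_sdiff.1 h
    have hkT := (hmemT k).2 (Or.inl hk)
    exact h2 (mem_touchedComponents.2 ⟨h1, k, hkT, k, hk, Or.inl rfl⟩)

/-- The change of the utility when a connected set of chords is added. -/
theorem utility_union {F K : Finset (Sym2 (Fin n))} (hK : Linked Crosses K) (hne : K.Nonempty) :
    utility (F ∪ K) - utility F = -((K \ F).card : ℤ) +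
      ((verts (K ∪ (touchedComponents F K).biUnion id)).card - 3 : ℤ) -
      ∑ J ∈ touchedComponents F K, (((verts J).card : ℤ) - 3) := by
  obtain ⟨h1, h2⟩ := circleComponents_union (F := F) hK hne
  have hsub : touchedComponents F K ⊆ circleComponents F := fun J hJ =>
    (mem_touchedComponents.1 hJ).1
  have hcard : (F ∪ K).card = (K \ F).card + F.card := by
    rw [Finset.union_comm, ← Finset.card_sdiff_add_card]
  have := Finset.sum_sdiff (f := fun J => (((verts J).card : ℤ) - 3)) hsub
  rw [utility, utility, h1, Finset.sum_insert h2, hcard, ← this]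
  push_cast
  ring

theorem utility_union_of_untouched {F K : Finset (Sym2 (Fin n))} (hK : Linked Crosses K)
    (hne : K.Nonempty) (h : touchedComponents F K = ∅) :
    utility (F ∪ K) - utility F = -((K \ F).card : ℤ) + ((verts K).card - 3 : ℤ) := by
  rw [utility_union hK hne, h]
  simp

/-- If `K` touches `r ≥ 1` components of `F`, then the utility changes by at least `-|K \ F|`, plus
the number of vertices of `K` outside these components, plus `r - 1`. -/
theorem le_utility_union {F K : Finset (Sym2 (Fin n))} (hF : ∀ e ∈ F, ¬ e.IsDiag)
    (hK : Linked Crosses K) (hne : K.Nonempty) (ht : (touchedComponents F K).Nonempty) :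
    -((K \ F).card : ℤ) +
        ((verts K \ verts ((touchedComponents F K).biUnion id)).card : ℤ) +
        (((touchedComponents F K).card : ℤ) - 1) ≤
      utility (F ∪ K) - utility F := by
  have hcomp : ∀ J ∈ touchedComponents F K, J ∈ circleComponents F := fun J hJ =>
    (mem_touchedComponents.1 hJ).1
  have hpack := sum_card_verts_sub_two_le ht
    (fun J hJ => (mem_circleComponents.1 (hcomp J hJ)).2.2.1)
    (fun J hJ J' hJ' e he he' => eq_of_mem_circleComponents (hcomp J hJ) (hcomp J' hJ') he he')
    (fun J hJ J' hJ' hJJ' e he f hf => (mem_circleComponents.1 (hcomp J hJ)).2.2.2 e he f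
      ((mem_circleComponents.1 (hcomp J' hJ')).1 hf) fun hfJ =>
        hJJ' (eq_of_mem_circleComponents (hcomp J hJ) (hcomp J' hJ') hfJ hf))
    (fun J hJ => by
      obtain ⟨h1, ⟨e, he⟩, -⟩ := mem_circleComponents.1 (hcomp J hJ)
      rw [← card_verts_singleton (hF e (h1 he))]
      exact Finset.card_le_card (verts_mono (by simpa using he)))
  rw [utility_union hK hne, verts_union, ← Finset.card_sdiff_add_card]
  simp only [Finset.sum_sub_distrib, Finset.sum_const, nsmul_eq_mul] at hpack ⊢
  push_cast
  linarith

/-! ### Feasibility in terms of the circle graph -/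

theorem cycleGraph_adj_iff {u v : Fin n} (hn : 4 ≤ n) :
    (SimpleGraph.cycleGraph n).Adj u v ↔ u.val + 1 = v.val ∨ v.val + 1 = u.val ∨
      (u.val = 0 ∧ v.val + 1 = n) ∨ (v.val = 0 ∧ u.val + 1 = n) := by
  rw [SimpleGraph.cycleGraph_adj', Fin.sub_def, Fin.sub_def]
  have hu := u.2
  have hv := v.2
  have key : ∀ a b : ℕ, a < n → b < n →
      ((n - b + a) % n = 1 ↔ b + 1 = a ∨ (a = 0 ∧ b + 1 = n)) := by
    intro a b ha hb
    by_cases h : b ≤ a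
    · have : n - b + a = (a - b) + n := by omega
      rw [this, Nat.add_mod_right, Nat.mod_eq_of_lt (by omega)]
      omega
    · rw [Nat.mod_eq_of_lt (by omega)]
      omega
  simp only [key _ _ hu hv, key _ _ hv hu]
  tauto

theorem isChord_mk_iff {u v : Fin n} (hn : 4 ≤ n) (huv : u ≤ v) :
    IsChord s(u, v) ↔ u.val + 2 ≤ v.val ∧ ¬ (u.val = 0 ∧ v.val + 1 = n) := by
  rw [IsChord, SimpleGraph.mem_edgeSet, SimpleGraph.compl_adj, cycleGraph_adj_iff hn, ne_eq,
    Fin.ext_iff]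
  omega

theorem IsChord.not_isDiag {e : Sym2 (Fin n)} (he : IsChord e) : ¬ e.IsDiag :=
  SimpleGraph.not_isDiag_of_mem_edgeSet _ he

/-- In a feasible solution every chord of the cycle is crossed: otherwise its endpoints form a
separating pair. -/
theorem ThreeConnects.exists_crosses {T : Finset (Sym2 (Fin n))} (hn : 4 ≤ n)
    (h : ThreeConnects T) {u v : Fin n} (huv : u ≤ v) (hc : IsChord s(u, v)) :
    ∃ e ∈ T, Crosses s(u, v) e := by
  rw [isChord_mk_iff hn huv] at hc
  have hv := v.2
  have hconn := h {u, v} (lt_of_le_of_lt Finset.card_le_two (by norm_num))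
  let x : Fin n := ⟨u.val + 1, by omega⟩
  have hx : x ∉ ({u, v} : Finset (Fin n)) := by
    simp only [Finset.mem_insert, Finset.mem_singleton, Fin.ext_iff, x]
    omega
  obtain ⟨y, hy⟩ : ∃ y : Fin n, y < u ∨ v < y := by
    by_cases h0 : u.val = 0
    · exact ⟨⟨v.val + 1, by omega⟩, Or.inr (by rw [Fin.lt_def]; simp)⟩
    · exact ⟨⟨0, by omega⟩, Or.inl (by rw [Fin.lt_def]; simp only; omega)⟩
  have hy' : y ∉ ({u, v} : Finset (Fin n)) := by
    simp only [Finset.mem_insert, Finset.mem_singleton]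
    omega
  obtain ⟨p⟩ := hconn.preconnected ⟨x, hx⟩ ⟨y, hy'⟩
  obtain ⟨d, -, hd1, hd2⟩ := p.exists_boundary_dart {z | u < z.1 ∧ z.1 < v}
    (by simp only [Set.mem_ofPred_eq, Fin.lt_def, x]; omega)
    (by simp only [Set.mem_ofPred_eq]; omega)
  have hadj : (SimpleGraph.cycleGraph n ⊔ SimpleGraph.fromEdgeSet (T : Set (Sym2 (Fin n)))).Adj
      d.fst.1 d.snd.1 := d.adj
  have hm : ∀ z : {z : Fin n | z ∉ ({u, v} : Finset (Fin n))}, z.1 ≠ u ∧ z.1 ≠ v := fun z => by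
    simpa using z.2
  have h1 := hm d.fst
  have h2 := hm d.snd
  simp only [Set.mem_ofPred_eq] at hd1 hd2
  rw [SimpleGraph.sup_adj, cycleGraph_adj_iff hn, SimpleGraph.fromEdgeSet_adj] at hadj
  rcases hadj with hadj | ⟨hadj, -⟩
  · omega
  · refine ⟨_, hadj, ?_⟩
    rcases le_total d.fst.1 d.snd.1 with hle | hle
    · rw [crosses_mk_iff huv hle]
      omega
    · rw [show s(d.fst.1, d.snd.1) = s(d.snd.1, d.fst.1) from Sym2.eq_swap, crosses_mk_iff huv hle]
      omega

theorem ThreeConnects.verts_eq_univ {T : Finset (Sym2 (Fin n))} (hn : 4 ≤ n)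
    (h : ThreeConnects T) : verts T = Finset.univ := by
  rw [Finset.eq_univ_iff_forall]
  intro v
  rw [mem_verts]
  have hv := v.2
  -- A link crossing the chord between the two neighbours of `v` ends in `v`.
  obtain ⟨a, b, hab, hc, hout⟩ : ∃ a b : Fin n, a ≤ b ∧ IsChord s(a, b) ∧
      ((∀ x, a < x → x < b → x = v) ∨ ∀ x, x < a ∨ b < x → x = v) := by
    by_cases h0 : v.val = 0
    · have hab : (⟨1, by omega⟩ : Fin n) ≤ ⟨n - 1, by omega⟩ := by
        rw [Fin.le_def]
        simp only
        omega
      refine ⟨_, _, hab, (isChord_mk_iff hn hab).2 ?_, Or.inr ?_⟩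
      · simp only
        omega
      · intro x hx
        rw [Fin.lt_def, Fin.lt_def] at hx
        simp only at hx
        omega
    · by_cases h1 : v.val + 1 = n
      · have hab : (⟨0, by omega⟩ : Fin n) ≤ ⟨n - 2, by omega⟩ := by
          rw [Fin.le_def]
          simp only
          omega
        refine ⟨_, _, hab, (isChord_mk_iff hn hab).2 ?_, Or.inr ?_⟩
        · simp only
          omega
        · intro x hx
          rw [Fin.lt_def, Fin.lt_def] at hx
          simp only at hx
          omega
      · have hab : (⟨v.val - 1, by omega⟩ : Fin n) ≤ ⟨v.val + 1, by omega⟩ := by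
          rw [Fin.le_def]
          simp only
          omega
        refine ⟨_, _, hab, (isChord_mk_iff hn hab).2 ?_, Or.inl ?_⟩
        · simp only
          omega
        · intro x hx hx'
          rw [Fin.lt_def] at hx hx'
          simp only at hx hx'
          omega
  obtain ⟨e, he, hcr⟩ := h.exists_crosses hn hab hc
  obtain ⟨x, y, hxy, rfl⟩ := exists_eq_mk_le e
  rw [crosses_mk_iff hab hxy] at hcr
  refine ⟨_, he, ?_⟩
  rw [Sym2.mem_iff]
  rcases hout with hout | hout
  · rcases hcr with hcr | hcr
    · exact Or.inl (hout x (by omega) (by omega)).symm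
    · exact Or.inr (hout y (by omega) (by omega)).symm
  · rcases hcr with hcr | hcr
    · exact Or.inr (hout y (by omega)).symm
    · exact Or.inl (hout x (by omega)).symm

/-- If two vertices `u`, `v` of a component `J` of a feasible solution form a chord of the cycle,
then a link of `J` crosses this chord, so that `J` has vertices on both sides of it. -/
theorem ThreeConnects.exists_mem_component {T J : Finset (Sym2 (Fin n))} (hn : 4 ≤ n)
    (h : ThreeConnects T) (hJ : J ∈ circleComponents T) {u v : Fin n} (hu : u ∈ verts J)
    (hv : v ∈ verts J) (huv : u ≤ v) (hc : IsChord s(u, v)) :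
    ∃ x ∈ verts J, ∃ y ∈ verts J, (u < x ∧ x < v) ∧ (y < u ∨ v < y) := by
  obtain ⟨hJT, -, hlink, hiso⟩ := mem_circleComponents.1 hJ
  obtain ⟨e, he, hcr⟩ := h.exists_crosses hn huv hc
  obtain ⟨g, hg, hge⟩ := hlink.exists_crosses hu hv hcr
  have heJ : e ∈ J := by
    by_contra heJ
    exact hiso g hg e he heJ hge
  obtain ⟨x, y, hxy, rfl⟩ := exists_eq_mk_le e
  rw [crosses_mk_iff huv hxy] at hcr
  have hx : x ∈ verts J := mem_verts.2 ⟨_, heJ, by simp⟩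
  have hy : y ∈ verts J := mem_verts.2 ⟨_, heJ, by simp⟩
  rcases hcr with hcr | hcr
  · exact ⟨x, hx, y, hy, by omega, by omega⟩
  · exact ⟨y, hy, x, hx, by omega, by omega⟩

/-- The circle graph of a feasible solution is connected. Given a component `J` and a link `cd`
outside of `J`, the component lies on one side of `cd`; the two vertices of `J` that are closest to
`c` and `d` form a chord, which contradicts `ThreeConnects.exists_mem_component`. -/
theorem ThreeConnects.linked {T : Finset (Sym2 (Fin n))} (hn : 4 ≤ n) (h : ThreeConnects T)
    (hT : ∀ e ∈ T, IsChord e) : Linked Crosses T := by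
  rcases T.eq_empty_or_nonempty with rfl | ⟨e₀, he₀⟩
  · intro P _ x hx
    simp at hx
  obtain ⟨J, hJ, he₀J⟩ := exists_mem_circleComponents he₀
  obtain ⟨hJT, -, hlink, hiso⟩ := mem_circleComponents.1 hJ
  suffices hTJ : T ⊆ J by rwa [hTJ.antisymm hJT]
  intro g hg
  by_contra hgJ
  obtain ⟨c, d, hcd, rfl⟩ := exists_eq_mk_le g
  have hgc := (isChord_mk_iff hn hcd).1 (hT _ hg)
  have hnc : ∀ e ∈ J, ¬ Crosses e s(c, d) := fun e he => hiso e he _ hg hgJ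
  obtain ⟨a, b, hab, rfl⟩ := exists_eq_mk_le e₀
  have hec := (isChord_mk_iff hn hab).1 (hT _ he₀)
  have haJ : a ∈ verts J := mem_verts.2 ⟨_, he₀J, by simp⟩
  have hbJ : b ∈ verts J := mem_verts.2 ⟨_, he₀J, by simp⟩
  -- The component contains the first and the last vertex of the cycle.
  have hne : (verts J).Nonempty := ⟨a, haJ⟩
  set u := (verts J).min' hne with hu
  set v := (verts J).max' hne with hv
  have huJ : u ∈ verts J := Finset.min'_mem _ _
  have hvJ : v ∈ verts J := Finset.max'_mem _ _
  have hmin : ∀ x ∈ verts J, u ≤ x := fun x hx => Finset.min'_le _ x hx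
  have hmax : ∀ x ∈ verts J, x ≤ v := fun x hx => Finset.le_max' _ x hx
  have hends : u.val = 0 ∧ v.val + 1 = n := by
    by_contra hends
    have h1 := hmin a haJ
    have h2 := hmax b hbJ
    have huv : u ≤ v := by omega
    obtain ⟨x, hx, y, hy, h3, h4⟩ := h.exists_mem_component hn hJ huJ hvJ huv
      ((isChord_mk_iff hn huv).2 ⟨by omega, hends⟩)
    have := hmin y hy
    have := hmax y hy
    omega
  -- Hence it has no vertex strictly between `c` and `d`.
  have hout : ∀ x ∈ verts J, x ≤ c ∨ d ≤ x := by
    intro x hx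
    by_contra! hx'
    have h1 := hlink.verts_between hnc hx hx'.1 hx'.2 u huJ
    have h2 := hlink.verts_between hnc hx hx'.1 hx'.2 v hvJ
    omega
  have hne1 : ((verts J).filter (· ≤ c)).Nonempty :=
    ⟨u, Finset.mem_filter.2 ⟨huJ, by omega⟩⟩
  have hne2 : ((verts J).filter (d ≤ ·)).Nonempty :=
    ⟨v, Finset.mem_filter.2 ⟨hvJ, by omega⟩⟩
  have hp := Finset.max'_mem _ hne1
  have hq := Finset.min'_mem _ hne2
  have hpmax : ∀ x ∈ verts J, x ≤ c → x ≤ ((verts J).filter (· ≤ c)).max' hne1 :=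
    fun x hx hxc => Finset.le_max' _ x (Finset.mem_filter.2 ⟨hx, hxc⟩)
  have hqmin : ∀ x ∈ verts J, d ≤ x → ((verts J).filter (d ≤ ·)).min' hne2 ≤ x :=
    fun x hx hxc => Finset.min'_le _ x (Finset.mem_filter.2 ⟨hx, hxc⟩)
  generalize ((verts J).filter (· ≤ c)).max' hne1 = p at hp hpmax
  generalize ((verts J).filter (d ≤ ·)).min' hne2 = q at hq hqmin
  rw [Finset.mem_filter] at hp hq
  have hpq : p ≤ q := by omega
  have hgap : ∀ x ∈ verts J, x ≤ p ∨ q ≤ x := fun x hx =>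
    (hout x hx).imp (hpmax x hx) (hqmin x hx)
  have h3 := hgap a haJ
  have h4 := hgap b hbJ
  obtain ⟨x, hx, -, -, h5, -⟩ := h.exists_mem_component hn hJ hp.1 hq.1 hpq
    ((isChord_mk_iff hn hpq).2 ⟨by omega, by omega⟩)
  have := hgap x hx
  omega

/-- A connected set of links that covers all vertices crosses every chord of the cycle. -/
theorem Linked.exists_crosses_chord {T : Finset (Sym2 (Fin n))} (hn : 4 ≤ n)
    (hT : Linked Crosses T) (hV : verts T = Finset.univ) {u v : Fin n} (huv : u ≤ v)
    (hc : IsChord s(u, v)) : ∃ e ∈ T, Crosses e s(u, v) := by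
  rw [isChord_mk_iff hn huv] at hc
  have hv := v.2
  by_contra! h
  have hbet := hT.verts_between (v := ⟨u.val + 1, by omega⟩) h (by simp [hV])
    (by rw [Fin.lt_def]; simp) (by rw [Fin.lt_def]; simp only; omega)
  have h1 := hbet ⟨0, by omega⟩ (by simp [hV])
  have h2 := hbet ⟨n - 1, by omega⟩ (by simp [hV])
  simp only [Fin.le_def] at h1 h2
  omega

/-- A connected set of links that covers all vertices is feasible. It suffices to delete exactly
two vertices; these leave two arcs of the cycle, which are joined by a link. -/
theorem Linked.threeConnects {T : Finset (Sym2 (Fin n))} (hn : 4 ≤ n)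
    (hT : Linked Crosses T) (hV : verts T = Finset.univ) : ThreeConnects T := by
  set G := SimpleGraph.cycleGraph n ⊔ SimpleGraph.fromEdgeSet (T : Set (Sym2 (Fin n))) with hG
  have key : ∀ u v : Fin n, u < v → ∀ x y : {z : Fin n | z ∉ ({u, v} : Finset (Fin n))},
      (G.induce {z : Fin n | z ∉ ({u, v} : Finset (Fin n))}).Reachable x y := by
    intro u v huv
    have hvn := v.2
    set H := G.induce {z : Fin n | z ∉ ({u, v} : Finset (Fin n))} with hH
    have hmem : ∀ z : Fin n, z ≠ u → z ≠ v → z ∈ {z : Fin n | z ∉ ({u, v} : Finset (Fin n))} :=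
      fun z h1 h2 => by simp [h1, h2]
    have hcyc : ∀ (x y : Fin n) (hx : x ≠ u ∧ x ≠ v) (hy : y ≠ u ∧ y ≠ v),
        (SimpleGraph.cycleGraph n).Adj x y →
          H.Reachable ⟨x, hmem x hx.1 hx.2⟩ ⟨y, hmem y hy.1 hy.2⟩ := by
      intro x y hx hy hxy
      have : H.Adj ⟨x, hmem x hx.1 hx.2⟩ ⟨y, hmem y hy.1 hy.2⟩ :=
        (show G.Adj x y from Or.inl hxy)
      exact this.reachable
    -- Walking along the cycle between two vertices with no deleted vertex in between.
    have hwalk : ∀ (k : ℕ) (x y : Fin n) (hx : x ≠ u ∧ x ≠ v) (hy : y ≠ u ∧ y ≠ v),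
        x.val + k = y.val → (∀ z, x ≤ z → z ≤ y → z ≠ u ∧ z ≠ v) →
          H.Reachable ⟨x, hmem x hx.1 hx.2⟩ ⟨y, hmem y hy.1 hy.2⟩ := by
      intro k
      induction k with
      | zero =>
        intro x y hx hy hk _
        have : x = y := by omega
        subst this
        rfl
      | succ k ih =>
        intro x y hx hy hk hz
        have hyn := y.2
        let y' : Fin n := ⟨x.val + k, by omega⟩
        have hy'1 : x ≤ y' := by
          rw [Fin.le_def]
          simp [y']
        have hy'2 : y' ≤ y := by
          rw [Fin.le_def]
          simp only [y']
          omega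
        have hy' := hz y' hy'1 hy'2
        refine (ih x y' hx hy' rfl fun z h1 h2 => hz z h1 (h2.trans hy'2)).trans ?_
        refine hcyc y' y hy' hy ((cycleGraph_adj_iff hn).2 (Or.inl ?_))
        simp only [y']
        omega
    have hwalk' : ∀ (x y : Fin n) (hx : x ≠ u ∧ x ≠ v) (hy : y ≠ u ∧ y ≠ v),
        (∀ z, x ≤ z → z ≤ y → z ≠ u ∧ z ≠ v) → (∀ z, y ≤ z → z ≤ x → z ≠ u ∧ z ≠ v) →
          H.Reachable ⟨x, hmem x hx.1 hx.2⟩ ⟨y, hmem y hy.1 hy.2⟩ := by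
      intro x y hx hy h1 h2
      rcases le_total x y with h | h
      · exact hwalk (y.val - x.val) x y hx hy (by omega) h1
      · exact (hwalk (x.val - y.val) y x hy hx (by omega) h2).symm
    have hin : ∀ (x y : Fin n) (hx : x ≠ u ∧ x ≠ v) (hy : y ≠ u ∧ y ≠ v),
        (u < x ∧ x < v) → (u < y ∧ y < v) →
          H.Reachable ⟨x, hmem x hx.1 hx.2⟩ ⟨y, hmem y hy.1 hy.2⟩ := by
      intro x y hx hy h1 h2
      exact hwalk' x y hx hy (fun z _ _ => by omega) fun z _ _ => by omega
    have hout : ∀ (x y : Fin n) (hx : x ≠ u ∧ x ≠ v) (hy : y ≠ u ∧ y ≠ v),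
        (x < u ∨ v < x) → (y < u ∨ v < y) →
          H.Reachable ⟨x, hmem x hx.1 hx.2⟩ ⟨y, hmem y hy.1 hy.2⟩ := by
      have hmix : ∀ (x y : Fin n) (hx : x ≠ u ∧ x ≠ v) (hy : y ≠ u ∧ y ≠ v), x < u → v < y →
          H.Reachable ⟨x, hmem x hx.1 hx.2⟩ ⟨y, hmem y hy.1 hy.2⟩ := by
        intro x y hx hy h1 h2
        have hyn := y.2
        let z : Fin n := ⟨0, by omega⟩
        let w : Fin n := ⟨n - 1, by omega⟩
        have hz : z < u := by
          rw [Fin.lt_def]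
          simp only [z]
          omega
        have hw : v < w := by
          rw [Fin.lt_def]
          simp only [w]
          omega
        have hz' : z ≠ u ∧ z ≠ v := by omega
        have hw' : w ≠ u ∧ w ≠ v := by omega
        refine (hwalk' x z hx hz' (fun t _ _ => by omega) fun t _ _ => by omega).trans ?_
        refine (hcyc z w hz' hw' ((cycleGraph_adj_iff hn).2 ?_)).trans ?_
        · have h3 : z.val = 0 := rfl
          have h4 : w.val = n - 1 := rfl
          omega
        · exact hwalk' w y hw' hy (fun t _ _ => by omega) fun t _ _ => by omega
      intro x y hx hy h1 h2
      rcases h1 with h1 | h1 <;> rcases h2 with h2 | h2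
      · exact hwalk' x y hx hy (fun t _ _ => by omega) fun t _ _ => by omega
      · exact hmix x y hx hy h1 h2
      · exact (hmix y x hy hx h2 h1).symm
      · exact hwalk' x y hx hy (fun t _ _ => by omega) fun t _ _ => by omega
    have hmix : ∀ (x y : Fin n) (hx : x ≠ u ∧ x ≠ v) (hy : y ≠ u ∧ y ≠ v),
        (u < x ∧ x < v) → (y < u ∨ v < y) →
          H.Reachable ⟨x, hmem x hx.1 hx.2⟩ ⟨y, hmem y hy.1 hy.2⟩ := by
      intro x y hx hy h1 h2
      have hyn := y.2
      obtain ⟨e, he, hcr⟩ := hT.exists_crosses_chord hn hV huv.le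
        ((isChord_mk_iff hn huv.le).2 ⟨by omega, by omega⟩)
      obtain ⟨a, b, hab, rfl⟩ := exists_eq_mk_le e
      rw [crosses_mk_iff hab huv.le] at hcr
      have ha : a ≠ u ∧ a ≠ v := by omega
      have hb : b ≠ u ∧ b ≠ v := by omega
      have hadj : H.Adj ⟨a, hmem a ha.1 ha.2⟩ ⟨b, hmem b hb.1 hb.2⟩ :=
        (show G.Adj a b from Or.inr ((SimpleGraph.fromEdgeSet_adj _).2 ⟨he, by omega⟩))
      by_cases hau : a < u
      · exact (hin x b hx hb h1 (by omega)).trans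
          (hadj.symm.reachable.trans (hout a y ha hy (by omega) h2))
      · exact (hin x a hx ha h1 (by omega)).trans
          (hadj.reachable.trans (hout b y hb hy (by omega) h2))
    rintro ⟨x, hx⟩ ⟨y, hy⟩
    have hx' : x ≠ u ∧ x ≠ v := by simpa using hx
    have hy' : y ≠ u ∧ y ≠ v := by simpa using hy
    by_cases h1 : u < x ∧ x < v <;> by_cases h2 : u < y ∧ y < v
    · exact hin x y hx' hy' h1 h2
    · exact hmix x y hx' hy' h1 (by omega)
    · exact (hmix y x hy' hx' h2 (by omega)).symm
    · exact hout x y hx' hy' (by omega) (by omega)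
  intro X hX
  have hcard : ∀ Y : Finset (Fin n), Y.card < n → ∃ z, z ∉ Y := by
    intro Y hY
    by_contra! hcon
    rw [Finset.eq_univ_iff_forall.2 hcon, Finset.card_univ, Fintype.card_fin] at hY
    exact lt_irrefl _ hY
  obtain ⟨z, hz⟩ := hcard X (by omega)
  have : Nonempty {v : Fin n | v ∉ X} := ⟨⟨z, hz⟩⟩
  refine ⟨fun x y => ?_⟩
  obtain ⟨x, hx⟩ := x
  obtain ⟨y, hy⟩ := y
  -- If fewer than two vertices are deleted, then two of them can be deleted without `x` and `y`.
  obtain ⟨Z, hXZ, hZ, hZcard⟩ : ∃ Z, X ⊆ Z ∧ Z ⊆ Finset.univ \ {x, y} ∧ Z.card = 2 := by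
    refine Finset.exists_subsuperset_card_eq ?_ (by omega) ?_
    · intro t ht
      simp only [Finset.mem_sdiff, Finset.mem_univ, true_and, Finset.mem_insert,
        Finset.mem_singleton, not_or]
      exact ⟨fun h => hx (h ▸ ht), fun h => hy (h ▸ ht)⟩
    · have h1 := Finset.card_sdiff_add_card_eq_card (Finset.subset_univ ({x, y} : Finset (Fin n)))
      rw [Finset.card_univ, Fintype.card_fin] at h1
      have h2 : ({x, y} : Finset (Fin n)).card ≤ 2 := Finset.card_le_two
      omega
  have hxZ : x ∉ Z := fun h => by simpa using hZ h
  have hyZ : y ∉ Z := fun h => by simpa using hZ h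
  obtain ⟨u, v, huv, rfl⟩ : ∃ u v : Fin n, u < v ∧ Z = {u, v} := by
    obtain ⟨u, v, huv, rfl⟩ := Finset.card_eq_two.1 hZcard
    rcases lt_or_gt_of_ne huv with h | h
    · exact ⟨u, v, h, rfl⟩
    · exact ⟨v, u, h, Finset.pair_comm u v⟩
  have hsub : {z : Fin n | z ∉ ({u, v} : Finset (Fin n))} ⊆ {z : Fin n | z ∉ X} :=
    fun t ht htX => ht (hXZ htX)
  exact (key u v huv ⟨x, hxZ⟩ ⟨y, hyZ⟩).map (SimpleGraph.induceHomOfLE G hsub).toHom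

/-! ### The size of a minimal completion -/

/-- A proper part `G` of a connected set `T` of links can be enlarged by a link of `T` without
decreasing the utility, unless `G` is connected and has all vertices of `T`: otherwise, some link of
`T \ G` crosses a given component `J` of `G` and has an endpoint outside of `J`. -/
theorem Linked.exists_utility_le {T G : Finset (Sym2 (Fin n))} (hT : Linked Crosses T)
    (hd : ∀ e ∈ T, ¬ e.IsDiag) (hGT : G ⊆ T) (hne : G.Nonempty) :
    (Linked Crosses G ∧ verts G = verts T) ∨ ∃ e ∈ T \ G, utility G ≤ utility (G ∪ {e}) := by
  obtain ⟨e₀, he₀⟩ := hne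
  obtain ⟨J, hJ, he₀J⟩ := exists_mem_circleComponents he₀
  obtain ⟨hJG, -, hlink, hiso⟩ := mem_circleComponents.1 hJ
  by_cases hex : ∃ e ∈ T \ G, (∃ g ∈ J, Crosses g e) ∧ ∃ v ∈ e, v ∉ verts J
  · right
    obtain ⟨e, he, ⟨g, hg, hge⟩, v, hve, hvJ⟩ := hex
    refine ⟨e, he, ?_⟩
    have hJt : J ∈ touchedComponents G {e} :=
      mem_touchedComponents.2 ⟨hJ, g, hg, e, by simp, Or.inr hge⟩
    have hgain := le_utility_union (F := G) (fun f hf => hd f (hGT hf)) (Linked.singleton e)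
      (Finset.singleton_nonempty e) ⟨J, hJt⟩
    have h1 : (({e} : Finset (Sym2 (Fin n))) \ G).card ≤ 1 :=
      (Finset.card_le_card Finset.sdiff_subset).trans (by simp)
    -- Either `e` merges two components, or its endpoint `v` is a new vertex.
    have h2 : 2 ≤ (touchedComponents G {e}).card +
        (verts {e} \ verts ((touchedComponents G {e}).biUnion id)).card := by
      have hpos : 0 < (touchedComponents G {e}).card := Finset.card_pos.2 ⟨J, hJt⟩
      by_cases h : (touchedComponents G {e}).card = 1
      · obtain ⟨J', hJ'⟩ := Finset.card_eq_one.1 h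
        obtain rfl : J = J' := by simpa [hJ'] using hJt
        have : 0 < (verts {e} \ verts ((touchedComponents G {e}).biUnion id)).card := by
          refine Finset.card_pos.2 ⟨v, Finset.mem_sdiff.2 ⟨mem_verts.2 ⟨e, by simp, hve⟩, ?_⟩⟩
          rwa [hJ', Finset.singleton_biUnion]
        omega
      · omega
    omega
  · left
    push Not at hex
    -- Every link of `T` belongs to `J` or is a chord between vertices of `J` crossing `J`.
    have key := hT (fun f => f ∈ J ∨ (f ∈ T \ G ∧ ∃ g ∈ J, Crosses g f)) ?_ e₀ (hGT he₀)
      (Or.inl he₀J)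
    · have hGJ : G = J := by
        refine Finset.Subset.antisymm (fun f hf => ?_) hJG
        rcases key f (hGT hf) with h | h
        · exact h
        · exact absurd hf (Finset.mem_sdiff.1 h.1).2
      rw [hGJ]
      refine ⟨hlink, (verts_mono (hJG.trans hGT)).antisymm fun v hv => ?_⟩
      obtain ⟨f, hf, hvf⟩ := mem_verts.1 hv
      rcases key f hf with h | h
      · exact mem_verts.2 ⟨f, h, hvf⟩
      · obtain ⟨h1, g, hg, hgf⟩ := h
        exact hex f h1 ⟨g, hg, hgf⟩ v hvf
    · intro f hf g hg hfg hPf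
      have hcr : ∃ h ∈ J, Crosses h g := by
        rcases hPf with h | ⟨h1, h, hh, hhf⟩
        · exact ⟨f, h, hfg⟩
        · have hends := hex f h1 ⟨h, hh, hhf⟩
          obtain ⟨a, b, -, rfl⟩ := exists_eq_mk_le f
          exact hlink.exists_crosses (hends a (by simp)) (hends b (by simp)) hfg
      by_cases hgG : g ∈ G
      · left
        by_contra hgJ
        obtain ⟨h, hh, hhg⟩ := hcr
        exact hiso h hh g hgG hgJ hhg
      · exact Or.inr ⟨Finset.mem_sdiff.2 ⟨hg, hgG⟩, hcr⟩

theorem utility_of_linked {T : Finset (Sym2 (Fin n))} (hT : Linked Crosses T) (hne : T.Nonempty) :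
    utility T = -(T.card : ℤ) + ((verts T).card - 3) := by
  rw [utility, circleComponents_of_linked hT hne, Finset.sum_singleton]

/-- The union of `F` and an inclusion-minimal completion `Q` of `F` has at most `n - 1 - U(F)`
links: links of `Q` can be added to `F` until `F ∪ Q` is reached, without decreasing the
utility, and the utility of `F ∪ Q` is `n - 3 - |F ∪ Q|`. Only if `F` is empty, the first
link costs two units. -/
theorem card_union_completion_le (hn : 4 ≤ n) {F Q : Finset (Sym2 (Fin n))}
    (hc : ∀ e ∈ F ∪ Q, IsChord e) (h : ThreeConnects (F ∪ Q))
    (hmin : ∀ Q' ⊆ Q, ThreeConnects (F ∪ Q') → Q ⊆ Q') :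
    ((F ∪ Q).card : ℤ) ≤ n - 1 - utility F := by
  classical
  set T := F ∪ Q with hTdef
  have hlink := h.linked hn hc
  have hV := h.verts_eq_univ hn
  have hd : ∀ e ∈ T, ¬ e.IsDiag := fun e he => (hc e he).not_isDiag
  have hTne : T.Nonempty := by
    obtain ⟨e, he, -⟩ := mem_verts.1 (show (⟨0, by omega⟩ : Fin n) ∈ verts T by simp [hV])
    exact ⟨e, he⟩
  let good : Finset (Sym2 (Fin n)) → Prop := fun G =>
    F ⊆ G ∧ G.Nonempty ∧ utility F - 2 ≤ utility G
  have hstart : (T.powerset.filter good).Nonempty := by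
    rcases F.eq_empty_or_nonempty with hF | hF
    · obtain ⟨e, he⟩ := hTne
      refine ⟨{e}, Finset.mem_filter.2 ⟨by simpa using he, by simp [hF], by simp, ?_⟩⟩
      rw [utility_of_linked (Linked.singleton e) (by simp), card_verts_singleton (hd e he), hF,
        utility_empty]
      simp
    · exact ⟨F, Finset.mem_filter.2 ⟨Finset.mem_powerset.2
        Finset.subset_union_left, subset_rfl, hF, by omega⟩⟩
  obtain ⟨G, hG, hmax⟩ := (T.powerset.filter good).exists_max_image Finset.card hstart
  rw [Finset.mem_filter, Finset.mem_powerset] at hG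
  obtain ⟨hGT, hFG, hGne, hU⟩ := hG
  have hfull : Linked Crosses G ∧ verts G = verts T := by
    refine (hlink.exists_utility_le hd hGT hGne).resolve_right ?_
    rintro ⟨e, he, hUe⟩
    rw [Finset.mem_sdiff] at he
    have := hmax (G ∪ {e}) (Finset.mem_filter.2 ⟨Finset.mem_powerset.2
      (Finset.union_subset hGT (by simpa using he.1)), hFG.trans Finset.subset_union_left,
      hGne.mono Finset.subset_union_left, hU.trans hUe⟩)
    rw [Finset.union_comm, ← Finset.insert_eq, Finset.card_insert_of_notMem he.2] at this
    omega
  have hFGF : F ∪ G \ F = G := Finset.union_sdiff_of_subset hFG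
  have hQ : Q ⊆ G \ F := by
    refine hmin (G \ F) (fun e he => ?_) ?_
    · obtain ⟨h1, h2⟩ := Finset.mem_sdiff.1 he
      exact (Finset.mem_union.1 (hGT h1)).resolve_left h2
    · rw [hFGF]
      exact hfull.1.threeConnects hn (hfull.2.trans hV)
  have hGeq : G = T := hGT.antisymm
    (Finset.union_subset hFG (hQ.trans Finset.sdiff_subset))
  rw [hGeq, utility_of_linked hlink hTne, hV, Finset.card_univ, Fintype.card_fin] at hU
  linarith

/-! ### Consequences of criticality -/

/-- A connected set of seven links with fourteen distinct endpoints shares at least five of them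
with a critical set. If it touched no component of `F`, it would increase the utility by `4`, which
exceeds `3/11 * 14`; otherwise it increases the utility by at least `w - 7`, where `w` is the number
of its endpoints outside of `F`, and this is at least `3/11 * w` unless `w ≤ 9`. -/
theorem IsCritical.five_le_card_inter {N : ℕ} (hN : 7 ≤ N) {S F K : Finset (Sym2 (Fin n))}
    (hd : ∀ e ∈ S, ¬ e.IsDiag) (hF : IsCritical (8 / 11 : ℝ) N S F) (hKS : K ⊆ S)
    (hK : Linked Crosses K) (hcard : K.card = 7) (hverts : (verts K).card = 14) :
    5 ≤ (verts K ∩ verts F).card := by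
  by_contra! hlt
  have hw := Finset.card_sdiff_add_card_inter (verts K) (verts F)
  have hKne : K.Nonempty := Finset.card_pos.1 (by omega)
  have hunion : F ∪ K \ F = F ∪ K := Finset.union_sdiff_self_eq_union
  refine hF.no_improvement ⟨K \ F, ?_, ?_, ?_, ?_, ?_⟩
  · exact Finset.sdiff_subset_sdiff hKS subset_rfl
  · rw [Finset.nonempty_iff_ne_empty, Ne, Finset.sdiff_eq_empty_iff_subset]
    intro hKF
    rw [Finset.inter_eq_left.2 (verts_mono hKF)] at hlt
    omega
  · exact (Finset.card_le_card Finset.sdiff_subset).trans (by omega)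
  · rw [hunion]
    rintro ⟨e, he⟩
    by_cases heF : e ∈ F
    · obtain ⟨f, hf⟩ := hF.singletonFree ⟨e, heF⟩
      exact ⟨⟨f.1, Finset.mem_union_left _ f.2⟩, hf⟩
    · have heK := (Finset.mem_union.1 he).resolve_left heF
      obtain ⟨x, hx, y, hy, hxy⟩ := hK.exists_boundary (K := {e})
        (Finset.ssubset_iff_subset_ne.2 ⟨by simpa using heK, fun h => by simp [← h] at hcard⟩)
        (by simp)
      rw [Finset.mem_singleton] at hx
      subst hx
      exact ⟨⟨y, Finset.mem_union_right _ (Finset.mem_sdiff.1 hy).1⟩, hxy⟩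
  · rw [hunion, verts_union, Finset.union_sdiff_left]
    have hKF : (K \ F).card ≤ 7 := hcard ▸ Finset.card_le_card Finset.sdiff_subset
    have key : 3 * ((verts K \ verts F).card : ℤ) ≤ 11 * (utility (F ∪ K) - utility F) := by
      rcases (touchedComponents F K).eq_empty_or_nonempty with ht | ht
      · have := utility_union_of_untouched hK hKne ht
        omega
      · have h1 := le_utility_union (fun e he => hd e (hF.subset he)) hK hKne ht
        have h2 : (verts K \ verts F).card ≤
            (verts K \ verts ((touchedComponents F K).biUnion id)).card := by
          refine Finset.card_le_card (Finset.sdiff_subset_sdiff subset_rfl (verts_mono ?_))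
          exact Finset.biUnion_subset.2 fun J hJ =>
            (mem_circleComponents.1 (mem_touchedComponents.1 hJ).1).1
        have h3 : 0 < (touchedComponents F K).card := Finset.card_pos.2 ht
        omega
    have key' : 3 * ((verts K \ verts F).card : ℝ) ≤
        11 * ((utility (F ∪ K) - utility F : ℤ) : ℝ) := by exact_mod_cast key
    linarith

/-- In a connected set `A` of links, either many endpoints coincide or many endpoints lie in the
critical set `F`. This is shown by repeatedly removing a set `B` of `6` to `10` links that hangs on
a single link `p`. If all endpoints of `B` are distinct and occur in no other link, then
`IsCritical.five_le_card_inter` applies to `p` and six links of `B`, and at least three of the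
common vertices with `F` are not endpoints of `p`. -/
theorem IsCritical.le_of_linked {N : ℕ} (hN : 7 ≤ N) {S F : Finset (Sym2 (Fin n))}
    (hd : ∀ e ∈ S, ¬ e.IsDiag) (hF : IsCritical (8 / 11 : ℝ) N S F) (A : Finset (Sym2 (Fin n)))
    (hAS : A ⊆ S) (hA : Linked Crosses A) :
    121 * (verts A).card + 9 * A.card ≤
      242 * A.card + 33 * (verts A ∩ verts F).card + 121 := by
  induction hm : A.card using Nat.strong_induction_on generalizing A with
  | _ m ih =>
  subst hm
  have hVA := card_verts_le A
  by_cases hsmall : A.card < 7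
  · omega
  obtain ⟨B, hBA, p, hp, hpB, hAB, hB6, hB10⟩ :=
    hA.exists_hanging crosses_symm (k := 6) (by norm_num) (by omega)
  have hcardAB := Finset.card_sdiff_add_card_eq_card hBA
  have hih := ih (A \ B).card (by omega) (A \ B) (Finset.sdiff_subset.trans hAS) hAB rfl
  have hpB' : p ∉ B := (Finset.mem_sdiff.1 hp).2
  set V' := verts (A \ B) with hV'
  have hVsplit : verts A = verts B ∪ V' := by
    rw [hV', ← verts_union, Finset.union_sdiff_of_subset hBA]
  have hVcard : (verts A).card = (verts B \ V').card + V'.card := by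
    rw [hVsplit, Finset.card_sdiff_add_card]
  have hVF : (V' ∩ verts F).card + ((verts B \ V') ∩ verts F).card ≤
      (verts A ∩ verts F).card := by
    rw [← Finset.card_union_of_disjoint]
    · refine Finset.card_le_card ?_
      rw [hVsplit]
      intro v hv
      simp only [Finset.mem_union, Finset.mem_inter, Finset.mem_sdiff] at hv ⊢
      tauto
    · rw [Finset.disjoint_left]
      intro v hv hv'
      simp only [Finset.mem_inter, Finset.mem_sdiff] at hv hv'
      tauto
  have hnew : (verts B \ V').card ≤ 2 * B.card :=
    (Finset.card_le_card Finset.sdiff_subset).trans (card_verts_le B)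
  by_cases hfull : (verts B \ V').card = 2 * B.card
  · obtain ⟨K, hKB, hpK, hKcard, hK⟩ := hpB.exists_subset_card crosses_symm
      (Finset.mem_insert_self p B) (k := 7) (by norm_num)
      (by rw [Finset.card_insert_of_notMem hpB']; omega)
    have hKS : K ⊆ S := hKB.trans
      (Finset.insert_subset (hAS (Finset.mem_sdiff.1 hp).1) (hBA.trans hAS))
    set K' := K.erase p with hK'
    have hK'card : K'.card = 6 := by rw [hK', Finset.card_erase_of_mem hpK, hKcard]
    have hK'B : K' ⊆ B := by
      intro e he
      obtain ⟨h1, h2⟩ := Finset.mem_erase.1 he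
      exact (Finset.mem_insert.1 (hKB h2)).resolve_left h1
    have hKeq : K = {p} ∪ K' := by rw [← Finset.insert_eq, hK', Finset.insert_erase hpK]
    have hpV' : verts {p} ⊆ V' := verts_mono (by simpa using hp)
    have hp2 := card_verts_singleton (hd p (hAS (Finset.mem_sdiff.1 hp).1))
    have hK'V : (verts K' \ V').card = 12 := by
      have h1 : verts B \ V' ⊆ (verts K' \ V') ∪ verts (B \ K') := by
        rw [← Finset.union_sdiff_of_subset hK'B, verts_union]
        intro v hv
        simp only [Finset.mem_union, Finset.mem_sdiff] at hv ⊢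
        rw [Finset.union_sdiff_of_subset hK'B]
        tauto
      have h2 := (Finset.card_le_card h1).trans (Finset.card_union_le _ _)
      have h3 := card_verts_le (B \ K')
      have h4 := Finset.card_sdiff_add_card_eq_card hK'B
      have h5 := (Finset.card_le_card (Finset.sdiff_subset (s := verts K') (t := V'))).trans
        (card_verts_le K')
      omega
    have hK'V' : verts K' \ V' = verts K' :=
      Finset.eq_of_subset_of_card_le Finset.sdiff_subset
        (by have := card_verts_le K'; omega)
    have hdisj : Disjoint (verts {p}) (verts K') := by
      rw [← hK'V']
      exact Finset.disjoint_sdiff.mono_left hpV'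
    have hKverts : (verts K).card = 14 := by
      rw [hKeq, verts_union, Finset.card_union_of_disjoint hdisj, hp2, ← hK'V', hK'V]
    have h5 := hF.five_le_card_inter hN hd hKS hK hKcard hKverts
    have h6 : (verts K ∩ verts F).card ≤ 2 + ((verts B \ V') ∩ verts F).card := by
      have h1 : verts K ∩ verts F ⊆ verts {p} ∪ ((verts B \ V') ∩ verts F) := by
        rw [hKeq, verts_union, ← hK'V']
        intro v hv
        have := @verts_mono _ _ _ hK'B v
        simp only [Finset.mem_union, Finset.mem_inter, Finset.mem_sdiff] at hv ⊢
        tauto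
      rw [← hp2]
      exact (Finset.card_le_card h1).trans (Finset.card_union_le _ _)
    omega
  · omega

/-! ### Runs of the algorithm -/

/-- The properties of `F` that are preserved by the first phase for `α = 8/11`. The last one says
that every vertex covered by `F` has been paid for with `1 - α` units of utility. -/
structure Invariant (S F : Finset (Sym2 (Fin n))) : Prop where
  subset : F ⊆ S
  singletonFree : SingletonFree F
  utility_ge : (1 - 8 / 11 : ℝ) * ((verts F).card : ℝ) ≤ (utility F : ℝ)

theorem invariant_empty (S : Finset (Sym2 (Fin n))) : Invariant S ∅ where
  subset := Finset.empty_subset S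
  singletonFree := fun e => absurd e.2 (Finset.notMem_empty _)
  utility_ge := by
    rw [utility_empty]
    simp [verts]

theorem PhaseOneStep.invariant {N : ℕ} {S F F' : Finset (Sym2 (Fin n))}
    (h : PhaseOneStep (8 / 11 : ℝ) N S F F') (hF : Invariant S F) : Invariant S F' := by
  obtain ⟨-, K, hK, rfl⟩ := h
  refine ⟨Finset.union_subset hF.subset (hK.subset.trans Finset.sdiff_subset), hK.singletonFree, ?_⟩
  have h1 := hK.gain
  have h2 := hF.utility_ge
  have h3 : (verts (F ∪ K)).card = (verts (F ∪ K) \ verts F).card + (verts F).card :=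
    (Finset.card_sdiff_add_card_eq_card (verts_mono Finset.subset_union_left)).symm
  rw [h3]
  push_cast at h1 ⊢
  linarith

theorem PhaseOneStep.card_lt {α : ℝ} {N : ℕ} {S F F' : Finset (Sym2 (Fin n))}
    (h : PhaseOneStep α N S F F') : F.card < F'.card := by
  obtain ⟨-, K, hK, rfl⟩ := h
  obtain ⟨e, he⟩ := hK.nonempty
  refine Finset.card_lt_card (Finset.ssubset_iff_of_subset Finset.subset_union_left |>.2
    ⟨e, Finset.mem_union_right _ he, (Finset.mem_sdiff.1 (hK.subset he)).2⟩)

theorem PhaseOneReaches.invariant {N : ℕ} {S F F' : Finset (Sym2 (Fin n))}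
    (h : PhaseOneReaches (8 / 11 : ℝ) N S F F') (hF : Invariant S F) : Invariant S F' := by
  induction h with
  | refl => exact hF
  | tail _ hstep ih => exact hstep.invariant ih

/-- The first phase can always be continued until a critical set is reached. -/
theorem Invariant.exists_isCritical {N : ℕ} {S F : Finset (Sym2 (Fin n))} (hF : Invariant S F) :
    ∃ F', PhaseOneReaches (8 / 11 : ℝ) N S F F' ∧ IsCritical (8 / 11 : ℝ) N S F' := by
  induction hm : S.card - F.card using Nat.strong_induction_on generalizing F with
  | _ m ih =>
  subst hm
  by_cases hcrit : IsCritical (8 / 11 : ℝ) N S F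
  · exact ⟨F, Relation.ReflTransGen.refl, hcrit⟩
  · have : ∃ K, IsImprovement (8 / 11 : ℝ) N S F K := by
      by_contra h
      exact hcrit ⟨hF.subset, hF.singletonFree, h⟩
    obtain ⟨K, hK⟩ := this
    have hstep : PhaseOneStep (8 / 11 : ℝ) N S F (F ∪ K) := ⟨hcrit, K, hK, rfl⟩
    have hinv := hstep.invariant hF
    have h1 := hstep.card_lt
    have h2 := Finset.card_le_card hinv.subset
    obtain ⟨F', hreach, hF'⟩ := ih _ (by omega) hinv rfl
    exact ⟨F', Relation.ReflTransGen.head hstep hreach, hF'⟩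

theorem exists_minimal_completion {S F : Finset (Sym2 (Fin n))} (hS : ThreeConnects S)
    (hF : F ⊆ S) : ∃ Q, Minimal (IsCompletion S F) Q := by
  have h : IsCompletion S F S := by
    refine ⟨subset_rfl, ?_⟩
    rw [Finset.union_eq_right.2 hF]
    exact ⟨subset_rfl, hS⟩
  exact exists_minimal_of_wellFoundedLT _ ⟨S, h⟩

/-- The bound on the size of the output. Writing `m` for the number of vertices of `F`, the output
has at most `n - 1 - 3/11 * m` links by `card_union_completion_le`, while
`IsCritical.le_of_linked`, applied to the optimum, bounds `n - 3/11 * m`. -/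
theorem ReturnsFrom.card_le {N : ℕ} (hn : 4 ≤ n) (hN : 7 ≤ N) {S Q F OPT : Finset (Sym2 (Fin n))}
    (hS : IsInstance S) (h : ReturnsFrom (8 / 11 : ℝ) N S ∅ Q F) (hO : IsFeasible S OPT) :
    ((Q ∪ F).card : ℝ) ≤ 233 / 121 * (OPT.card : ℝ) := by
  have hinv := h.reaches.invariant (invariant_empty S)
  have hmin := h.minimal
  have hd : ∀ e ∈ S, ¬ e.IsDiag := fun e he => (hS.isChord e he).not_isDiag
  have hsize := card_union_completion_le hn (fun e he => hS.isChord e (hmin.prop.2.1 he))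
    hmin.prop.2.2 fun Q' hQ' hcon => hmin.le_of_le
      ⟨hQ'.trans hmin.prop.1, Finset.union_subset hinv.subset (hQ'.trans hmin.prop.1), hcon⟩ hQ'
  have hOPT := h.critical.le_of_linked hN hd OPT hO.1
    (hO.2.linked hn fun e he => hS.isChord e (hO.1 he))
  rw [hO.2.verts_eq_univ hn, Finset.univ_inter, Finset.card_univ, Fintype.card_fin] at hOPT
  have hU := hinv.utility_ge
  have h1 : ((F ∪ Q).card : ℝ) ≤ n - 1 - (utility F : ℝ) := by exact_mod_cast hsize
  have h2 : (121 : ℝ) * n + 9 * OPT.card ≤ 242 * OPT.card + 33 * (verts F).card + 121 := by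
    exact_mod_cast hOPT
  rw [Finset.union_comm]
  linarith

end CycleVCA

theorem mainTheorem2 (n : ℕ) (hn : 4 ≤ n) (S : Finset (Sym2 (Fin n)))
    (hS : CycleVCA.IsInstance S) (N : ℕ) (hN : 9 ≤ N) :
    -- the while loop performs at most `|S|` iterations
    (∀ (q : ℕ) (F : ℕ → Finset (Sym2 (Fin n))), F 0 = ∅ →
      (∀ i < q, CycleVCA.PhaseOneStep (8 / 11 : ℝ) N S (F i) (F (i + 1))) → q ≤ S.card) ∧
    -- the algorithm never gets stuck: every partial run can be continued to an output
    (∀ F₁ : Finset (Sym2 (Fin n)), CycleVCA.PhaseOneReaches (8 / 11 : ℝ) N S ∅ F₁ →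
      ∃ Q F : Finset (Sym2 (Fin n)), CycleVCA.ReturnsFrom (8 / 11 : ℝ) N S F₁ Q F) ∧
    -- every possible output is feasible and within the ratio `233 / 121` of the optimum
    (∀ Q F : Finset (Sym2 (Fin n)), CycleVCA.ReturnsFrom (8 / 11 : ℝ) N S ∅ Q F →
      CycleVCA.IsFeasible S (Q ∪ F) ∧
      ∀ OPT : Finset (Sym2 (Fin n)), CycleVCA.IsOptimal S OPT →
        ((Q ∪ F).card : ℝ) ≤ 233 / 121 * (OPT.card : ℝ)) := by
  refine ⟨fun q F h0 hstep => ?_, fun F₁ hF₁ => ?_, fun Q F h => ⟨?_, fun OPT hOPT => ?_⟩⟩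
  · have key : ∀ i ≤ q, CycleVCA.Invariant S (F i) ∧ i ≤ (F i).card := by
      intro i
      induction i with
      | zero =>
        intro _
        rw [h0]
        exact ⟨CycleVCA.invariant_empty S, Nat.zero_le _⟩
      | succ i ih =>
        intro hi
        have hs := hstep i (by omega)
        obtain ⟨h1, h2⟩ := ih (by omega)
        exact ⟨hs.invariant h1, by have := hs.card_lt; omega⟩
    obtain ⟨h1, h2⟩ := key q le_rfl
    exact h2.trans (Finset.card_le_card h1.subset)
  · obtain ⟨F, hreach, hcrit⟩ :=
      (hF₁.invariant (CycleVCA.invariant_empty S)).exists_isCritical (N := N)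
    obtain ⟨Q, hQ⟩ := CycleVCA.exists_minimal_completion hS.threeConnects hcrit.subset
    exact ⟨Q, F, hreach, hcrit, hQ⟩
  · rw [Finset.union_comm]
    exact h.minimal.prop.2
  · exact h.card_le hn (by omega) hS hOPT.1
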